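/- Let $x_1,\dots,x_N\in\mathbb R^3$ be points in general position (no four coplanar) whose orthogonal projections $\pi(x_1),\dots,\pi(x_N)$ onto the first two coordinates are, in this order, the consecutive vertices of a convex polygon. For $i<i'<j<j'$ the projected segments $\pi(x_i)\pi(x_j)$ and $\pi(x_{i'})\pi(x_{j'})$ cross in exactly one point; we say that the segment $x_ix_j$ is above $x_{i'}x_{j'}$ if, over this crossing point, the point of $x_ix_j$ has larger third coordinate than the point of $x_{i'}x_{j'}$, and below otherwise. For $k\ge 4$ let $\operatorname{AB}(k)$ be the smallest integer $N$ such that every such sequence $x_1,\dots,x_N$ contains indices $1\le i_1<\dots<i_k\le N$ for which either $x_{i_r}x_{i_t}$ is above $x_{i_s}x_{i_u}$ for all $1\le r<s<t<u\le k$, or $x_{i_r}x_{i_t}$ is below $x_{i_s}x_{i_u}$ for all $1\le r<s<t<u\le k$. Theorem. The number $\operatorname{AB}(k)$ exists for every $k\ge 4$, and there are absolute constants $c,C>0$ such that for all $k\ge 4$ $$2^{2^{ck}}\le \operatorname{AB}(k)\le 2^{2^{Ck}}.$$ -/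

import Mathlib

/-- Points of `ℝ³` in general position: any at most four of the points are affinely independent
(in particular no four of them are coplanar). -/
def InGeneralPosition {N : ℕ} (x : Fin N → (Fin 3 → ℝ)) : Prop :=
  ∀ s : Finset (Fin N), s.card ≤ 4 → AffineIndependent ℝ (fun i : s => x i)

/-- The orthogonal projection of `ℝ³` onto the first two coordinates. -/
def planeProj (x : Fin 3 → ℝ) : Fin 2 → ℝ := ![x 0, x 1]

/-- `p` lists the consecutive vertices of a (strictly) convex polygon in the plane, in either
orientation: the points are distinct and, for every edge `p i`, `p (i + 1)` (indices mod `N`),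
all the other points lie strictly on the same side of the line through that edge. -/
def IsConvexPolygon {N : ℕ} (p : Fin N → (Fin 2 → ℝ)) : Prop :=
  Function.Injective p ∧
    ∀ i j k : Fin N, j ≠ i → j ≠ finRotate N i → k ≠ i → k ≠ finRotate N i →
      (affineSpan ℝ {p i, p (finRotate N i)}).SSameSide (p j) (p k)

/-- The segment `ab` is above the segment `cd`: over the crossing point of the projected
segments, the point of `ab` has larger third coordinate than the point of `cd`. -/
def IsAbove (a b c d : Fin 3 → ℝ) : Prop :=
  ∃ u ∈ segment ℝ a b, ∃ v ∈ segment ℝ c d, planeProj u = planeProj v ∧ v 2 < u 2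

/-- The segment `ab` is below the segment `cd` when it is not above it. (Used only for segments
whose projections cross in exactly one point.) -/
def IsBelow (a b c d : Fin 3 → ℝ) : Prop := ¬ IsAbove a b c d

/-- Every sequence of `N` points of `ℝ³` in general position whose projections are the
consecutive vertices of a convex polygon has a `k`-term subsequence on which all comparisons of
crossing diagonals are "above", or all are "below". -/
def ForcesAB (N k : ℕ) : Prop :=
  ∀ x : Fin N → (Fin 3 → ℝ), InGeneralPosition x → IsConvexPolygon (fun i => planeProj (x i)) →
    ∃ i : Fin k → Fin N, StrictMono i ∧
      ((∀ r s t u : Fin k, r < s → s < t → t < u →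
          IsAbove (x (i r)) (x (i t)) (x (i s)) (x (i u))) ∨
       (∀ r s t u : Fin k, r < s → s < t → t < u →
          IsBelow (x (i r)) (x (i t)) (x (i s)) (x (i u))))

/-- The above-below Ramsey function: the smallest `N` such that every admissible sequence of `N`
points has a homogeneous `k`-term subsequence. -/
noncomputable def AB (k : ℕ) : ℕ := sInf {N : ℕ | ForcesAB N k}

/-!
Over a convex polygon, the segment `x_i x_k` is above `x_j x_l` (`i < j < k < l`) according to the
orientation of the tetrahedron `x_i x_j x_k x_l` (`isAbove_iff_vol_pos`), since the weights of the
crossing point are the areas of triangles of the projection. So the theorem is about subsequences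
whose tetrahedra all have the same orientation.

*Upper bound.* All triples of vertices of a convex polygon are oriented alike
(`IsConvexPolygon.orient_pos_or_neg`). Hence the affine dependence of five points
(`vol_relations`) makes the two-colouring of quadruples transitive: if `abcd` and `bcde` have the
same colour, so has every quadruple of these five points. It is therefore enough to find a monotone
path, a sequence all of whose consecutive quadruples have one colour. If there is none on `n + 3`
points, each pair of points carries a lower set of the grid `[n] × [n]`, of the possible lengths of
paths in the two colours that end with this pair, and pairs `jk`, `kl` get different lower sets.
A lower set is given by its boundary path, so there are at most `2 ^ (2 n)` of them, and the
family of lower sets of the pairs ending at a point determines the point. This leaves at most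
`2 ^ 2 ^ (2 n)` points (`card_le_of_no_path`).

*Lower bound.* Points `(t, t ^ 2, y)` with increasing `t` project to a convex polygon. In such a
sequence every point is replaced by a tiny copy of a second sequence, sheared to be very steep but
kept nearly straight. Quadruples with points in four different copies, or all in one copy, behave as
in the two sequences, and the sign of every other quadruple depends only on how it is distributed
among the copies (`BlowUpSigns`). These signs are such that a homogeneous subsequence without its
two end points lies in one copy or meets every copy at most once
(`BlowUpSigns.homogeneousBound`). Thus blowing up a sequence by itself squares its length and adds
only two to the length of its homogeneous subsequences, and iteration gives `2 ^ 2 ^ q` points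
without homogeneous subsequences of more than `2 q + 2` terms (`exists_smallHomogeneous`).
-/

/-! ### Orientation and crossing segments -/

/-- Twice the signed area of the triangle `p q r`; positive when it is traversed
counterclockwise. -/
def orient (p q r : Fin 2 → ℝ) : ℝ :=
  (q 0 - p 0) * (r 1 - p 1) - (q 1 - p 1) * (r 0 - p 0)

/-- Minus six times the signed volume of the tetrahedron `a b c d`, expanded along the third
coordinates. The sign is chosen so that `ac` above `bd` means a positive value when the
projections are in counterclockwise convex position. -/
def vol (a b c d : Fin 3 → ℝ) : ℝ :=
  orient (planeProj b) (planeProj c) (planeProj d) * a 2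
    - orient (planeProj a) (planeProj c) (planeProj d) * b 2
    + orient (planeProj a) (planeProj b) (planeProj d) * c 2
    - orient (planeProj a) (planeProj b) (planeProj c) * d 2

/-- The crossing point of the projected diagonals has barycentric weights given by the areas of
the four triangles, so the difference of heights over it is `vol` up to a positive factor. -/
theorem isAbove_iff_vol_pos {a b c d : Fin 3 → ℝ}
    (ha : 0 < orient (planeProj b) (planeProj c) (planeProj d))
    (hb : 0 < orient (planeProj a) (planeProj c) (planeProj d))
    (hc : 0 < orient (planeProj a) (planeProj b) (planeProj d))
    (hd : 0 < orient (planeProj a) (planeProj b) (planeProj c)) :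
    IsAbove a c b d ↔ 0 < vol a b c d := by
  unfold vol
  set o₁ := orient (planeProj b) (planeProj c) (planeProj d) with h1
  set o₂ := orient (planeProj a) (planeProj c) (planeProj d) with h2
  set o₃ := orient (planeProj a) (planeProj b) (planeProj d) with h3
  set o₄ := orient (planeProj a) (planeProj b) (planeProj c) with h4
  simp only [orient, planeProj, Matrix.cons_val_zero, Matrix.cons_val_one] at h1 h2 h3 h4
  have hsum : o₁ + o₃ = o₂ + o₄ := by rw [h1, h2, h3, h4]; ring
  have hx : o₁ * a 0 + o₃ * c 0 = o₂ * b 0 + o₄ * d 0 := by rw [h1, h2, h3, h4]; ring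
  have hy : o₁ * a 1 + o₃ * c 1 = o₂ * b 1 + o₄ * d 1 := by rw [h1, h2, h3, h4]; ring
  have hpos : 0 < o₁ + o₃ := by positivity
  constructor
  · rintro ⟨u, ⟨α, α', hα, hα', hαα, rfl⟩, v, ⟨β, β', hβ, hβ', hββ, rfl⟩, hp, hz⟩
    have e0 := congrFun hp 0
    have e1 := congrFun hp 1
    simp [planeProj] at e0 e1 hz
    obtain rfl : α = 1 - α' := by linarith
    obtain rfl : β = 1 - β' := by linarith
    -- Cramer's rule: the parameters of the crossing point are determined.
    have hα2 : α' * (o₁ + o₃) = o₃ := by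
      rw [h1, h3]
      linear_combination (d 1 - b 1) * e0 - (d 0 - b 0) * e1
    have hβ2 : β' * (o₁ + o₃) = o₄ := by
      rw [hsum, h2, h4]
      linear_combination (c 1 - a 1) * e0 - (c 0 - a 0) * e1
    have : o₁ * a 2 - o₂ * b 2 + o₃ * c 2 - o₄ * d 2
        = (o₁ + o₃) * (((1 - α') * a 2 + α' * c 2) - ((1 - β') * b 2 + β' * d 2)) := by
      linear_combination (a 2 - c 2) * hα2 - (b 2 - d 2) * hβ2 + b 2 * hsum
    rw [this]
    exact mul_pos hpos (by linarith)
  · intro h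
    refine ⟨(o₁ / (o₁ + o₃)) • a + (o₃ / (o₁ + o₃)) • c,
      ⟨_, _, by positivity, by positivity, by field_simp, rfl⟩,
      (o₂ / (o₁ + o₃)) • b + (o₄ / (o₁ + o₃)) • d,
      ⟨_, _, by positivity, by positivity, by rw [hsum]; field_simp, rfl⟩, ?_, ?_⟩
    · ext i
      fin_cases i
      · simp [planeProj]; field_simp; linarith
      · simp [planeProj]; field_simp; linarith
    · simp only [Pi.add_apply, Pi.smul_apply, smul_eq_mul]
      have e : (o₁ / (o₁ + o₃) * a 2 + o₃ / (o₁ + o₃) * c 2)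
          - (o₂ / (o₁ + o₃) * b 2 + o₄ / (o₁ + o₃) * d 2)
          = (o₁ * a 2 - o₂ * b 2 + o₃ * c 2 - o₄ * d 2) / (o₁ + o₃) := by
        field_simp; ring
      have := div_pos h hpos
      linarith

theorem isAbove_swap_right {a b c d : Fin 3 → ℝ} : IsAbove a b c d ↔ IsAbove a b d c := by
  unfold IsAbove; rw [segment_symm ℝ c d]

/-- For a clockwise polygon the sign is reversed: exchanging `b` and `d` reverses the order of the
projections and leaves the two segments unchanged. -/
theorem isAbove_iff_vol_neg {a b c d : Fin 3 → ℝ}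
    (ha : orient (planeProj b) (planeProj c) (planeProj d) < 0)
    (hb : orient (planeProj a) (planeProj c) (planeProj d) < 0)
    (hc : orient (planeProj a) (planeProj b) (planeProj d) < 0)
    (hd : orient (planeProj a) (planeProj b) (planeProj c) < 0) :
    IsAbove a c b d ↔ vol a b c d < 0 := by
  have key : ∀ p q r, orient r q p = - orient p q r := by intro p q r; unfold orient; ring
  have key2 : ∀ p q r, orient p r q = - orient p q r := by intro p q r; unfold orient; ring
  rw [isAbove_swap_right, isAbove_iff_vol_pos (a := a) (b := d) (c := c) (d := b)]
  · unfold vol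
    rw [key, key2 (planeProj a) (planeProj b) (planeProj c),
      key2 (planeProj a) (planeProj c) (planeProj d), key2 (planeProj a) (planeProj b) (planeProj d)]
    constructor <;> intro h <;> linarith
  · rw [key]; linarith
  · rw [key2]; linarith
  · rw [key2]; linarith
  · rw [key2]; linarith

/-! ### Orientations in a convex polygon -/

theorem orient_eq_zero_iff_mem {p q : Fin 2 → ℝ} (hpq : p ≠ q) (z : Fin 2 → ℝ) :
    orient p q z = 0 ↔ z ∈ affineSpan ℝ {p, q} := by
  constructor
  · intro hz
    unfold orient at hz
    by_cases h0 : q 0 - p 0 = 0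
    · have h1 : q 1 - p 1 ≠ 0 := by
        intro h1; apply hpq; ext i; fin_cases i
        · simp; linarith
        · simp; linarith
      have hz0 : z 0 - p 0 = 0 := by
        rw [h0] at hz; simpa [h1] using hz
      have := AffineMap.lineMap_mem_affineSpan_pair ((z 1 - p 1) / (q 1 - p 1)) p q
      convert this using 1
      ext i; fin_cases i
      · simp [AffineMap.lineMap_apply, h0]; linarith
      · simp [AffineMap.lineMap_apply]; field_simp; ring
    · have := AffineMap.lineMap_mem_affineSpan_pair ((z 0 - p 0) / (q 0 - p 0)) p q
      convert this using 1
      ext i; fin_cases i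
      · simp [AffineMap.lineMap_apply]; field_simp; ring
      · simp [AffineMap.lineMap_apply]; field_simp; linarith
  · intro hz
    obtain ⟨r, rfl⟩ := mem_affineSpan_pair_iff_exists_lineMap_eq.1 hz
    simp [orient, AffineMap.lineMap_apply]; ring

/-- Two points lie strictly on the same side of a line if and only if they span with it triangles
of the same orientation. -/
theorem sSameSide_iff_orient_mul_pos {p q a b : Fin 2 → ℝ} (hpq : p ≠ q) :
    (affineSpan ℝ {p, q}).SSameSide a b ↔ 0 < orient p q a * orient p q b := by
  constructor
  · rintro ⟨⟨u, hu, v, hv, hray⟩, ha, hb⟩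
    have ha' : orient p q a ≠ 0 := fun h => ha ((orient_eq_zero_iff_mem hpq a).1 h)
    have hb' : orient p q b ≠ 0 := fun h => hb ((orient_eq_zero_iff_mem hpq b).1 h)
    have hu' := (orient_eq_zero_iff_mem hpq u).2 hu
    have hv' := (orient_eq_zero_iff_mem hpq v).2 hv
    obtain ⟨w, α, β, hα, hβ, -, h1, h2⟩ := hray.exists_eq_smul
    have ea : orient p q a = α * ((q 0 - p 0) * w 1 - (q 1 - p 1) * w 0) := by
      have e0 := congrFun h1 0
      have e1 := congrFun h1 1
      simp at e0 e1
      unfold orient at hu' ⊢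
      linear_combination hu' + (q 0 - p 0) * e1 - (q 1 - p 1) * e0
    have eb : orient p q b = β * ((q 0 - p 0) * w 1 - (q 1 - p 1) * w 0) := by
      have e0 := congrFun h2 0
      have e1 := congrFun h2 1
      simp at e0 e1
      unfold orient at hv' ⊢
      linear_combination hv' + (q 0 - p 0) * e1 - (q 1 - p 1) * e0
    have hne : orient p q a * orient p q b ≠ 0 := mul_ne_zero ha' hb'
    refine lt_of_le_of_ne ?_ hne.symm
    rw [ea, eb]
    have : 0 ≤ α * β * ((q 0 - p 0) * w 1 - (q 1 - p 1) * w 0) ^ 2 := by positivity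
    linarith
  · intro h
    have hn : (q 0 - p 0) ^ 2 + (q 1 - p 1) ^ 2 ≠ 0 := by
      intro hn
      have h0 : q 0 - p 0 = 0 := by nlinarith [sq_nonneg (q 0 - p 0), sq_nonneg (q 1 - p 1)]
      have h1 : q 1 - p 1 = 0 := by nlinarith [sq_nonneg (q 0 - p 0), sq_nonneg (q 1 - p 1)]
      unfold orient at h
      rw [h0, h1] at h
      simp at h
    -- The feet of the perpendiculars from `a` and `b` to the line.
    set n := (q 0 - p 0) ^ 2 + (q 1 - p 1) ^ 2 with hndef
    let w : Fin 2 → ℝ := ![-(q 1 - p 1), q 0 - p 0]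
    have foot : ∀ z, z - (orient p q z / n) • w ∈ affineSpan ℝ {p, q} := by
      intro z
      rw [← orient_eq_zero_iff_mem hpq]
      have e : orient p q (z - (orient p q z / n) • w)
          = orient p q z - orient p q z / n * n := by
        generalize orient p q z / n = c
        simp [orient, w, hndef]; ring
      rw [e]; field_simp; ring
    refine ⟨⟨_, foot a, _, foot b, ?_⟩, ?_, ?_⟩
    · simp only [vsub_eq_sub, sub_sub_cancel]
      refine Or.inr (Or.inr ⟨orient p q b ^ 2, orient p q a * orient p q b, ?_, h, ?_⟩)
      · have := right_ne_zero_of_mul h.ne'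
        positivity
      · rw [smul_smul, smul_smul]; congr 1; ring
    · rw [← orient_eq_zero_iff_mem hpq]; exact left_ne_zero_of_mul h.ne'
    · rw [← orient_eq_zero_iff_mem hpq]; exact right_ne_zero_of_mul h.ne'

/-- If every point lies on the left of every edge `p i`, `p (i + 1)`, then all triples are
oriented counterclockwise: as seen from `p i` the other points lie in a half-plane, in which
turning left is a transitive relation by the Plücker identity. -/
theorem orient_pos_of_edges {N : ℕ} {p : ℕ → Fin 2 → ℝ}
    (h : ∀ i j, i + 1 < N → j < N → j ≠ i → j ≠ i + 1 → 0 < orient (p i) (p (i + 1)) (p j))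
    {i j k : ℕ} (hij : i < j) (hjk : j < k) (hk : k < N) : 0 < orient (p i) (p j) (p k) := by
  have cyc : ∀ a b c, orient a b c = orient b c a := by intro a b c; unfold orient; ring
  induction k, hjk using Nat.le_induction with
  | base => rw [cyc]; exact h j i (by omega) (by omega) (by omega) (by omega)
  | succ k hjk ih =>
    have h1 := ih (by omega)
    by_cases hj : j = i + 1
    · subst hj; exact h i (k + 1) (by omega) (by omega) (by omega) (by omega)
    have h2 := h k i (by omega) (by omega) (by omega) (by omega)
    rw [← cyc] at h2
    have h3 := h i j (by omega) (by omega) (by omega) (by omega)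
    have h4 := h i k (by omega) (by omega) (by omega) (by omega)
    have h5 := h i (k + 1) (by omega) (by omega) (by omega) (by omega)
    have pl : orient (p i) (p (i + 1)) (p k) * orient (p i) (p j) (p (k + 1))
        = orient (p i) (p (i + 1)) (p j) * orient (p i) (p k) (p (k + 1))
          + orient (p i) (p (i + 1)) (p (k + 1)) * orient (p i) (p j) (p k) := by
      unfold orient; ring
    refine pos_of_mul_pos_right (b := orient (p i) (p j) (p (k + 1))) ?_ h4.le
    rw [pl]; positivity

/-- All triples of vertices of a convex polygon, listed in order, have the same orientation. -/
theorem IsConvexPolygon.orient_pos_or_neg {N : ℕ} {p : Fin N → Fin 2 → ℝ}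
    (h : IsConvexPolygon p) :
    (∀ i j k, i < j → j < k → 0 < orient (p i) (p j) (p k)) ∨
      (∀ i j k, i < j → j < k → orient (p i) (p j) (p k) < 0) := by
  by_cases hN : N < 3
  · left; intro i j k hij hjk; omega
  obtain ⟨n, rfl⟩ : ∃ n, N = n + 3 := ⟨N - 3, by omega⟩
  obtain ⟨hinj, hside⟩ := h
  set P : ℕ → Fin 2 → ℝ := fun i => if hi : i < n + 3 then p ⟨i, hi⟩ else 0 with hP
  have hPv : ∀ i : Fin (n + 3), P i = p i := by intro i; simp [hP]
  have cyc : ∀ a b c, orient a b c = orient b c a := by intro a b c; unfold orient; ring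
  have hedge : ∀ i j k, i + 1 < n + 3 → j < n + 3 → k < n + 3 → j ≠ i → j ≠ i + 1 → k ≠ i →
      k ≠ i + 1 → 0 < orient (P i) (P (i + 1)) (P j) * orient (P i) (P (i + 1)) (P k) := by
    intro i j k hi hj hk h1 h2 h3 h4
    have hrot : finRotate (n + 3) ⟨i, by omega⟩ = ⟨i + 1, hi⟩ :=
      finRotate_of_lt (n := n + 2) (by omega)
    have := hside ⟨i, by omega⟩ ⟨j, hj⟩ ⟨k, hk⟩ (by simpa [Fin.ext_iff] using h1)
      (by rw [hrot]; simpa [Fin.ext_iff] using h2) (by simpa [Fin.ext_iff] using h3)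
      (by rw [hrot]; simpa [Fin.ext_iff] using h4)
    rw [hrot] at this
    have := (sSameSide_iff_orient_mul_pos (by
      intro he; have := hinj he; simp [Fin.ext_iff] at this)).1 this
    simpa [hP, show i < n + 3 by omega, hi, hj, hk] using this
  -- Consecutive edges share a triangle, so the common sign propagates along the polygon.
  have hall : ∀ i j, i + 1 < n + 3 → j < n + 3 → j ≠ i → j ≠ i + 1 →
      0 < orient (P 0) (P 1) (P 2) * orient (P i) (P (i + 1)) (P j) := by
    intro i
    induction i with
    | zero => intro j hi hj h1 h2; exact hedge 0 2 j hi (by omega) hj (by omega) (by omega) h1 h2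
    | succ i ih =>
      intro j hi hj h1 h2
      have e1 := ih (i + 2) (by omega) (by omega) (by omega) (by omega)
      have e2 := hedge (i + 1) i j hi (by omega) hj (by omega) (by omega) h1 h2
      rw [← cyc] at e2
      by_contra hcon
      have : orient (P 0) (P 1) (P 2) * orient (P i) (P (i + 1)) (P (i + 2))
        * (orient (P i) (P (i + 1)) (P (i + 2)) * orient (P (i + 1)) (P (i + 1 + 1)) (P j))
        ≤ 0 := by
        have := mul_nonneg (sq_nonneg (orient (P i) (P (i + 1)) (P (i + 2))))
          (neg_nonneg.2 (not_lt.1 hcon))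
        linarith
      have := mul_pos e1 e2
      linarith
  rcases lt_trichotomy 0 (orient (P 0) (P 1) (P 2)) with hs | hs | hs
  · left
    intro i j k hij hjk
    rw [← hPv, ← hPv, ← hPv]
    exact orient_pos_of_edges (N := n + 3)
      (fun a b h1 h2 h3 h4 => (mul_pos_iff_of_pos_left hs).1 (hall a b h1 h2 h3 h4)) hij hjk k.2
  · have := hall 0 2 (by omega) (by omega) (by omega) (by omega)
    rw [← hs] at this; simp at this
  · right
    intro i j k hij hjk
    rw [← hPv, ← hPv, ← hPv]
    -- Exchanging the two coordinates reverses all orientations.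
    have fl : ∀ a b c : Fin 2 → ℝ,
        orient ![a 1, a 0] ![b 1, b 0] ![c 1, c 0] = - orient a b c := by
      intro a b c; simp [orient]
    have := orient_pos_of_edges (N := n + 3) (p := fun i => ![P i 1, P i 0])
      (fun a b h1 h2 h3 h4 => by
        rw [fl]
        have := hall a b h1 h2 h3 h4
        have := neg_of_mul_pos_right this hs.le
        linarith) hij hjk k.2
    rw [fl] at this
    linarith

/-- The affine dependence of five points: eliminating two of the points leaves relations between
the remaining volumes. They make the sign of `vol` transitive. -/
theorem vol_relations (a b c d e : Fin 3 → ℝ) :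
    vol a b d e * orient (planeProj b) (planeProj c) (planeProj d)
      = vol b c d e * orient (planeProj a) (planeProj b) (planeProj d)
        + vol a b c d * orient (planeProj b) (planeProj d) (planeProj e) ∧
    vol a c d e * orient (planeProj b) (planeProj d) (planeProj e)
      = vol b c d e * orient (planeProj a) (planeProj d) (planeProj e)
        + vol a b d e * orient (planeProj c) (planeProj d) (planeProj e) ∧
    vol a b c e * orient (planeProj a) (planeProj b) (planeProj d)
      = vol a b d e * orient (planeProj a) (planeProj b) (planeProj c)
        + vol a b c d * orient (planeProj a) (planeProj b) (planeProj e) := by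
  simp only [vol, orient, planeProj, Matrix.cons_val_zero, Matrix.cons_val_one]
  refine ⟨by ring, by ring, by ring⟩

/-! ### Transitive colourings of quadruples -/

/-- A property of increasing quadruples is transitive if, for five points in increasing order, it
passes from the first four and the last four to all other quadruples among the five. -/
def TransitiveQuad {N : ℕ} (R : Fin N → Fin N → Fin N → Fin N → Prop) : Prop :=
  ∀ a b c d e, a < b → b < c → c < d → d < e → R a b c d → R b c d e →
    R a b c e ∧ R a b d e ∧ R a c d e

/-- `EndsPath R m i j k`: there is an increasing sequence of `m + 3` indices ending with
`i, j, k`, all of whose quadruples of consecutive terms satisfy `R`. Only the terms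
`f 0, …, f (m + 2)` of the infinite sequence `f` matter. -/
def EndsPath {N : ℕ} (R : Fin N → Fin N → Fin N → Fin N → Prop) (m : ℕ) (i j k : Fin N) : Prop :=
  ∃ f : ℕ → Fin N, (∀ a < m + 2, f a < f (a + 1)) ∧
    (∀ a < m, R (f a) (f (a + 1)) (f (a + 2)) (f (a + 3))) ∧
    f m = i ∧ f (m + 1) = j ∧ f (m + 2) = k

theorem endsPath_zero {N : ℕ} {R : Fin N → Fin N → Fin N → Fin N → Prop} {i j k : Fin N}
    (hij : i < j) (hjk : j < k) : EndsPath R 0 i j k := by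
  refine ⟨fun a => if a = 0 then i else if a = 1 then j else k, ?_, by simp, rfl, rfl, rfl⟩
  intro a ha
  obtain rfl | rfl : a = 0 ∨ a = 1 := by omega
  · simpa using hij
  · simpa using hjk

theorem EndsPath.succ {N : ℕ} {R : Fin N → Fin N → Fin N → Fin N → Prop} {m : ℕ}
    {i j k l : Fin N} (h : EndsPath R m i j k) (hkl : k < l) (hR : R i j k l) :
    EndsPath R (m + 1) j k l := by
  obtain ⟨f, h1, h2, rfl, rfl, rfl⟩ := h
  have hlow : ∀ a, a < m + 3 → Function.update f (m + 3) l a = f a := fun a ha =>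
    Function.update_of_ne (by omega) _ _
  refine ⟨Function.update f (m + 3) l, ?_, ?_, hlow _ (by omega), hlow _ (by omega), by simp⟩
  · intro a ha
    rcases Nat.lt_or_ge a (m + 2) with h | h
    · rw [hlow _ (by omega), hlow _ (by omega)]; exact h1 a h
    · obtain rfl : a = m + 2 := by omega
      rw [hlow _ (by omega)]; simpa using hkl
  · intro a ha
    rcases Nat.lt_or_ge a m with h | h
    · rw [hlow _ (by omega), hlow _ (by omega), hlow _ (by omega), hlow _ (by omega)]
      exact h2 a h
    · obtain rfl : a = m := by omega
      rw [hlow _ (by omega), hlow _ (by omega), hlow _ (by omega)]; simpa using hR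

theorem EndsPath.mono {N : ℕ} {R : Fin N → Fin N → Fin N → Fin N → Prop} {m n : ℕ}
    {i j k : Fin N} (h : EndsPath R n i j k) (hmn : m ≤ n) : EndsPath R m i j k := by
  obtain ⟨f, h1, h2, h3, h4, h5⟩ := h
  obtain ⟨d, rfl⟩ := Nat.exists_eq_add_of_le hmn
  refine ⟨fun a => f (a + d), fun a ha => ?_, fun a ha => ?_, ?_, ?_, ?_⟩
  · have := h1 (a + d) (by omega); rwa [show a + d + 1 = a + 1 + d by omega] at this
  · have := h2 (a + d) (by omega)
    rwa [show a + d + 1 = a + 1 + d by omega, show a + d + 2 = a + 2 + d by omega,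
      show a + d + 3 = a + 3 + d by omega] at this
  · exact h3
  · rw [← h4]; exact congrArg f (by omega)
  · rw [← h5]; exact congrArg f (by omega)

/-- A transitive property that holds for consecutive quadruples of a sequence holds for all of
them: a quadruple skipping an index is obtained from two quadruples of smaller span. -/
theorem transitive_of_consecutive {m : ℕ} {Q : ℕ → ℕ → ℕ → ℕ → Prop}
    (hQ : ∀ a b c d e, a < b → b < c → c < d → d < e → e < m → Q a b c d → Q b c d e →
      Q a b c e ∧ Q a b d e ∧ Q a c d e)
    (h : ∀ a, a + 3 < m → Q a (a + 1) (a + 2) (a + 3)) :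
    ∀ s x y z w, w ≤ x + s → x < y → y < z → z < w → w < m → Q x y z w := by
  intro s
  induction s with
  | zero => intros; omega
  | succ s ih =>
    intro x y z w hs hxy hyz hzw hw
    by_cases h1 : y = x + 1
    · by_cases h2 : z = y + 1
      · by_cases h3 : w = z + 1
        · subst h3 h2 h1; exact h x hw
        · exact (hQ x y z (z + 1) w hxy hyz (by omega) (by omega) hw
            (ih _ _ _ _ (by omega) hxy hyz (by omega) (by omega))
            (ih _ _ _ _ (by omega) hyz (by omega) (by omega) hw)).1
      · exact (hQ x y (y + 1) z w hxy (by omega) (by omega) hzw hw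
            (ih _ _ _ _ (by omega) hxy (by omega) (by omega) (by omega))
            (ih _ _ _ _ (by omega) (by omega) (by omega) hzw hw)).2.1
    · exact (hQ x (x + 1) y z w (by omega) (by omega) hyz hzw hw
            (ih _ _ _ _ (by omega) (by omega) (by omega) hyz (by omega))
            (ih _ _ _ _ (by omega) (by omega) hyz hzw hw)).2.2

theorem EndsPath.exists_homogeneous {N n : ℕ} {R : Fin N → Fin N → Fin N → Fin N → Prop}
    (hR : TransitiveQuad R) {i j k : Fin N} (h : EndsPath R n i j k) :
    ∃ g : Fin (n + 3) → Fin N, StrictMono g ∧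
      ∀ r s t u, r < s → s < t → t < u → R (g r) (g s) (g t) (g u) := by
  obtain ⟨f, h1, h2, -, -, -⟩ := h
  have hmono : ∀ b a, a < b → b < n + 3 → f a < f b := by
    intro b
    induction b with
    | zero => intros; omega
    | succ b ih =>
      intro a ha hb
      have h3 := h1 b (by omega)
      rcases Nat.lt_or_ge a b with h | h
      · exact (ih a h (by omega)).trans h3
      · obtain rfl : a = b := by omega
        exact h3
  refine ⟨fun a => f a, fun a b hab => hmono b a hab b.2, ?_⟩
  intro r s t u hrs hst htu
  refine transitive_of_consecutive (m := n + 3) (Q := fun a b c d => R (f a) (f b) (f c) (f d))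
    ?_ (fun a ha => h2 a (by omega)) u r s t u (by omega) hrs hst htu u.2
  intro a b c d e hab hbc hcd hde he
  exact hR _ _ _ _ _ (hmono _ _ hab (by omega)) (hmono _ _ hbc (by omega))
    (hmono _ _ hcd (by omega)) (hmono _ _ hde (by omega))

/-! ### Counting lower sets of a grid -/

/-- The code of a lower set `S` of the grid `[n] × [n]`: the positions of the vertical steps of
its boundary path, which has `2 n` steps. -/
noncomputable def lowerCode (n : ℕ) (S : ℕ → ℕ → Prop) : Finset (Fin (2 * n)) := by
  classical
  exact Finset.univ.filter fun x => ∃ a : ℕ, a < n ∧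
    (x : ℕ) = a + (n - ((Finset.range n).filter fun b => S a b).card)

/-- A lower set of the grid is determined by its boundary path. Hence there are at most
`2 ^ (2 n)` lower sets. -/
theorem lowerCode_injective {n : ℕ} {S T : ℕ → ℕ → Prop}
    (hS : ∀ a b a' b', S a b → a' ≤ a → b' ≤ b → S a' b')
    (hT : ∀ a b a' b', T a b → a' ≤ a → b' ≤ b → T a' b')
    (hSn : ∀ a, ¬ S a n) (hTn : ∀ a, ¬ T a n) (hSn' : ∀ b, ¬ S n b) (hTn' : ∀ b, ¬ T n b)
    (h : lowerCode n S = lowerCode n T) : ∀ a b, S a b ↔ T a b := by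
  classical
  -- column heights
  let g : (ℕ → ℕ → Prop) → ℕ → ℕ := fun S a => ((Finset.range n).filter fun b => S a b).card
  have hgn : ∀ S a, g S a ≤ n := fun S a => by
    simpa using Finset.card_filter_le (Finset.range n) (fun b => S a b)
  have hganti : ∀ S : ℕ → ℕ → Prop, (∀ a b a' b', S a b → a' ≤ a → b' ≤ b → S a' b') →
      ∀ a a', a' ≤ a → g S a ≤ g S a' := by
    intro S hS a a' h
    refine Finset.card_le_card fun b => ?_
    simp only [Finset.mem_filter]
    exact fun hb => ⟨hb.1, hS _ _ _ _ hb.2 h le_rfl⟩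
  have hmem : ∀ S : ℕ → ℕ → Prop, (∀ a b a' b', S a b → a' ≤ a → b' ≤ b → S a' b') →
      (∀ a, ¬ S a n) → ∀ a b, S a b ↔ b < g S a := by
    intro S hS hSn a b
    constructor
    · intro hb
      have : Finset.range (b + 1) ⊆ (Finset.range n).filter fun b => S a b := by
        intro c hc
        simp only [Finset.mem_range, Finset.mem_filter] at hc ⊢
        refine ⟨?_, hS _ _ _ _ hb le_rfl (by omega)⟩
        by_contra hcn
        exact hSn a (hS _ _ _ _ hb le_rfl (by omega))
      simpa using Finset.card_le_card this
    · intro hb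
      by_contra hcon
      have : ((Finset.range n).filter fun b => S a b) ⊆ Finset.range b := by
        intro c hc
        simp only [Finset.mem_range, Finset.mem_filter] at hc ⊢
        by_contra hcb
        exact hcon (hS _ _ _ _ hc.2 le_rfl (by omega))
      have := Finset.card_le_card this
      rw [Finset.card_range] at this
      exact absurd hb (not_lt.2 this)
  have hsm : ∀ S : ℕ → ℕ → Prop, (∀ a b a' b', S a b → a' ≤ a → b' ≤ b → S a' b') →
      StrictMono fun a : Fin n => (a : ℕ) + (n - g S a) := by
    intro S hS a b hab
    have := hganti S hS b a (Fin.le_def.1 hab.le)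
    have h3 : (a : ℕ) < b := hab
    show (a : ℕ) + (n - g S a) < b + (n - g S b)
    omega
  have hrange : Set.range (fun a : Fin n => (a : ℕ) + (n - g S a))
      = Set.range (fun a : Fin n => (a : ℕ) + (n - g T a)) := by
    ext x
    have key : ∀ S : ℕ → ℕ → Prop, x ∈ Set.range (fun a : Fin n => (a : ℕ) + (n - g S a)) ↔
        ∃ hx : x < 2 * n, (⟨x, hx⟩ : Fin (2 * n)) ∈ lowerCode n S := by
      intro S
      simp only [lowerCode, Finset.mem_filter, Finset.mem_univ, true_and, Set.mem_range]
      constructor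
      · rintro ⟨a, rfl⟩
        exact ⟨by have := a.2; omega, a, a.2, rfl⟩
      · rintro ⟨hx, a, ha, hxa⟩
        exact ⟨⟨a, ha⟩, hxa.symm⟩
    rw [key, key, h]
  have hfun := ((hsm S hS).range_inj (hsm T hT)).1 hrange
  intro a b
  rcases Nat.lt_or_ge a n with ha | ha
  · rw [hmem S hS hSn, hmem T hT hTn]
    have h1 := congrFun hfun ⟨a, ha⟩
    have h2 := hgn S a
    have h3 := hgn T a
    simp only at h1
    have : g S a = g T a := by omega
    rw [this]
  · exact ⟨fun h => absurd (hS _ _ _ _ h ha le_rfl) (hSn' b),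
      fun h => absurd (hT _ _ _ _ h ha le_rfl) (hTn' b)⟩

/-! ### The Ramsey theorem for transitive colourings -/

/-- A colouring of quadruples by `R` and its negation, without monochromatic monotone paths on
`n + 3` vertices, lives on at most `2 ^ 2 ^ (2 n)` points. The pair `j < k` is given the lower
set of all `(a, b)` such that, for some `i`, paths of lengths `a` and `b` in the two colours
end with `i, j, k`; the pairs `jk` and `kl` get distinct sets, as the colour of `ijkl` extends
one of the two paths. Hence the point `l` is determined by the family of lower sets of the
pairs `jl`. -/
theorem card_le_of_no_path {N n : ℕ} {R : Fin N → Fin N → Fin N → Fin N → Prop}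
    (h₁ : ∀ i j k, ¬ EndsPath R n i j k)
    (h₂ : ∀ i j k, ¬ EndsPath (fun a b c d => ¬ R a b c d) n i j k) :
    N ≤ 2 ^ 2 ^ (2 * n) := by
  classical
  let R' : Fin N → Fin N → Fin N → Fin N → Prop := fun a b c d => ¬ R a b c d
  let S : Fin N → Fin N → ℕ → ℕ → Prop := fun j k a b =>
    ∃ i, i < j ∧ EndsPath R a i j k ∧ EndsPath R' b i j k
  have hlow : ∀ j k a b a' b', S j k a b → a' ≤ a → b' ≤ b → S j k a' b' := by
    rintro j k a b a' b' ⟨i, hi, ha, hb⟩ haa hbb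
    exact ⟨i, hi, ha.mono haa, hb.mono hbb⟩
  have hS1 : ∀ j k a, ¬ S j k a n := fun j k a ⟨i, _, _, h⟩ => h₂ i j k h
  have hS2 : ∀ j k a, ¬ S j k n a := fun j k a ⟨i, _, h, _⟩ => h₁ i j k h
  have hne : ∀ j k l, j < k → k < l → lowerCode n (S j k) ≠ lowerCode n (S k l) := by
    intro j k l hjk hkl heq
    have hiff := lowerCode_injective (hlow j k) (hlow k l) (hS1 j k) (hS1 k l) (hS2 j k)
      (hS2 k l) heq
    have ha := Nat.findGreatest_spec (P := fun a => EndsPath R a j k l) (Nat.zero_le n)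
      (endsPath_zero hjk hkl)
    have hb := Nat.findGreatest_spec (P := fun a => EndsPath R' a j k l) (Nat.zero_le n)
      (endsPath_zero hjk hkl)
    set a := Nat.findGreatest (fun a => EndsPath R a j k l) n with hadef
    set b := Nat.findGreatest (fun a => EndsPath R' a j k l) n with hbdef
    obtain ⟨i, hi, hia, hib⟩ := (hiff a b).2 ⟨j, hjk, ha, hb⟩
    by_cases hc : R i j k l
    · have h3 := hia.succ hkl hc
      have h4 : a + 1 ≤ n := by
        by_contra hcon
        exact h₁ _ _ _ (h3.mono (by omega))
      have := Nat.le_findGreatest (P := fun a => EndsPath R a j k l) h4 h3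
      omega
    · have h3 := hib.succ hkl hc
      have h4 : b + 1 ≤ n := by
        by_contra hcon
        exact h₂ _ _ _ (h3.mono (by omega))
      have := Nat.le_findGreatest (P := fun a => EndsPath R' a j k l) h4 h3
      omega
  let E : Fin N → Finset (Finset (Fin (2 * n))) := fun l =>
    (Finset.univ.filter fun j => j < l).image fun j => lowerCode n (S j l)
  have hE : ∀ k l, k < l → E k ≠ E l := by
    intro k l hkl heq
    have hm : lowerCode n (S k l) ∈ E l :=
      Finset.mem_image_of_mem _ (by simpa using hkl)
    rw [← heq] at hm
    obtain ⟨j, hj, hjk⟩ := Finset.mem_image.1 hm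
    exact hne j k l (by simpa using hj) hkl hjk
  have hinj : Function.Injective E := by
    intro k l hkl
    rcases lt_trichotomy k l with h | h | h
    · exact absurd hkl (hE _ _ h)
    · exact h
    · exact absurd hkl.symm (hE _ _ h)
  simpa using Fintype.card_le_of_injective E hinj

theorem exists_homogeneous_of_transitive {N n : ℕ} {R : Fin N → Fin N → Fin N → Fin N → Prop}
    (hR : TransitiveQuad R) (hR' : TransitiveQuad fun a b c d => ¬ R a b c d)
    (hN : 2 ^ 2 ^ (2 * n) < N) :
    ∃ g : Fin (n + 3) → Fin N, StrictMono g ∧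
      ((∀ r s t u, r < s → s < t → t < u → R (g r) (g s) (g t) (g u)) ∨
       (∀ r s t u, r < s → s < t → t < u → ¬ R (g r) (g s) (g t) (g u))) := by
  by_contra hcon
  refine absurd hN (not_lt.2 (card_le_of_no_path (R := R) ?_ ?_))
  · intro i j k h
    obtain ⟨g, hg, h⟩ := h.exists_homogeneous hR
    exact hcon ⟨g, hg, Or.inl h⟩
  · intro i j k h
    obtain ⟨g, hg, h⟩ := h.exists_homogeneous hR'
    exact hcon ⟨g, hg, Or.inr h⟩

/-- Five points over a counterclockwise convex polygon: a sign of `vol` shared by the first and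
the last four of them is shared by all quadruples. -/
theorem transitive_vol {N : ℕ} {x : Fin N → Fin 3 → ℝ}
    (ho : ∀ i j k, i < j → j < k →
      0 < orient (planeProj (x i)) (planeProj (x j)) (planeProj (x k))) :
    TransitiveQuad (fun a b c d => 0 < vol (x a) (x b) (x c) (x d)) ∧
      TransitiveQuad (fun a b c d => ¬ 0 < vol (x a) (x b) (x c) (x d)) := by
  constructor
  · intro a b c d e hab hbc hcd hde h1 h2
    obtain ⟨r1, r2, r3⟩ := vol_relations (x a) (x b) (x c) (x d) (x e)
    have p1 := ho b c d hbc hcd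
    have p2 := ho a b d hab (hbc.trans hcd)
    have p3 := ho b d e (hbc.trans hcd) hde
    have p4 := ho a d e (hab.trans (hbc.trans hcd)) hde
    have p5 := ho c d e hcd hde
    have p6 := ho a b c hab hbc
    have p7 := ho a b e hab (hbc.trans (hcd.trans hde))
    have q1 : 0 < vol (x a) (x b) (x d) (x e) :=
      pos_of_mul_pos_left (by rw [r1]; positivity) p1.le
    exact ⟨pos_of_mul_pos_left (by rw [r3]; positivity) p2.le, q1,
      pos_of_mul_pos_left (by rw [r2]; positivity) p3.le⟩
  · intro a b c d e hab hbc hcd hde h1 h2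
    rw [not_lt] at h1 h2
    obtain ⟨r1, r2, r3⟩ := vol_relations (x a) (x b) (x c) (x d) (x e)
    have p1 := ho b c d hbc hcd
    have p2 := ho a b d hab (hbc.trans hcd)
    have p3 := ho b d e (hbc.trans hcd) hde
    have p4 := ho a d e (hab.trans (hbc.trans hcd)) hde
    have p5 := ho c d e hcd hde
    have p6 := ho a b c hab hbc
    have p7 := ho a b e hab (hbc.trans (hcd.trans hde))
    have np : ∀ u v : ℝ, u ≤ 0 → 0 < v → u * v ≤ 0 := fun u v hu hv =>
      mul_nonpos_of_nonpos_of_nonneg hu hv.le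
    have q1 : vol (x a) (x b) (x d) (x e) ≤ 0 :=
      nonpos_of_mul_nonpos_left (by rw [r1]; exact add_nonpos (np _ _ h2 p2) (np _ _ h1 p3)) p1
    exact ⟨not_lt.2 (nonpos_of_mul_nonpos_left
        (by rw [r3]; exact add_nonpos (np _ _ q1 p6) (np _ _ h1 p7)) p2), not_lt.2 q1,
      not_lt.2 (nonpos_of_mul_nonpos_left
        (by rw [r2]; exact add_nonpos (np _ _ h2 p4) (np _ _ q1 p5)) p3)⟩

theorem forcesAB_of_lt {N n : ℕ} (hN : 2 ^ 2 ^ (2 * n) < N) : ForcesAB N (n + 3) := by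
  intro x _ hconv
  rcases hconv.orient_pos_or_neg with ho | ho
  · obtain ⟨hT, hT'⟩ := transitive_vol ho
    obtain ⟨g, hg, h⟩ := exists_homogeneous_of_transitive hT hT' hN
    have key : ∀ r s t u, r < s → s < t → t < u →
        (IsAbove (x (g r)) (x (g t)) (x (g s)) (x (g u)) ↔
          0 < vol (x (g r)) (x (g s)) (x (g t)) (x (g u))) := fun r s t u h1 h2 h3 =>
      isAbove_iff_vol_pos (ho _ _ _ (hg h2) (hg h3)) (ho _ _ _ (hg (h1.trans h2)) (hg h3))
        (ho _ _ _ (hg h1) (hg (h2.trans h3))) (ho _ _ _ (hg h1) (hg h2))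
    exact ⟨g, hg, h.imp (fun h r s t u h1 h2 h3 => (key r s t u h1 h2 h3).2 (h r s t u h1 h2 h3))
      (fun h r s t u h1 h2 h3 => (key r s t u h1 h2 h3).not.2 (h r s t u h1 h2 h3))⟩
  · -- A clockwise polygon becomes counterclockwise when the first coordinate is reflected.
    let z : Fin N → Fin 3 → ℝ := fun i => ![-x i 0, x i 1, x i 2]
    have hz : ∀ i j k, orient (planeProj (z i)) (planeProj (z j)) (planeProj (z k))
        = - orient (planeProj (x i)) (planeProj (x j)) (planeProj (x k)) := by
      intro i j k; simp [orient, planeProj, z]; ring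
    have hv : ∀ i j k l, vol (z i) (z j) (z k) (z l) = - vol (x i) (x j) (x k) (x l) := by
      intro i j k l; simp only [vol, hz]; simp [z]; ring
    obtain ⟨hT, hT'⟩ := transitive_vol (x := z) (fun i j k h1 h2 => by
      rw [hz]; have := ho i j k h1 h2; linarith)
    obtain ⟨g, hg, h⟩ := exists_homogeneous_of_transitive hT hT' hN
    have key : ∀ r s t u, r < s → s < t → t < u →
        (IsAbove (x (g r)) (x (g t)) (x (g s)) (x (g u)) ↔
          0 < vol (z (g r)) (z (g s)) (z (g t)) (z (g u))) := fun r s t u h1 h2 h3 => by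
      rw [hv, neg_pos]
      exact isAbove_iff_vol_neg (ho _ _ _ (hg h2) (hg h3)) (ho _ _ _ (hg (h1.trans h2)) (hg h3))
        (ho _ _ _ (hg h1) (hg (h2.trans h3))) (ho _ _ _ (hg h1) (hg h2))
    exact ⟨g, hg, h.imp (fun h r s t u h1 h2 h3 => (key r s t u h1 h2 h3).2 (h r s t u h1 h2 h3))
      (fun h r s t u h1 h2 h3 => (key r s t u h1 h2 h3).not.2 (h r s t u h1 h2 h3))⟩

/-! ### Sets of quadruples of one sign in a lexicographic product -/

/-- All increasing quadruples in `s` satisfy `R`. -/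
def HomogeneousSet {α : Type} [LT α] (R : α → α → α → α → Prop) (s : Finset α) : Prop :=
  ∀ a ∈ s, ∀ b ∈ s, ∀ c ∈ s, ∀ d ∈ s, a < b → b < c → c < d → R a b c d

/-- The number `H` bounds the sizes of the sets on which `F` is positive on all increasing
quadruples, and of those on which it is negative. -/
def HomogeneousBound {α : Type} [LT α] (F : α → α → α → α → ℝ) (H : ℕ) : Prop :=
  (∀ s : Finset α, HomogeneousSet (fun a b c d => 0 < F a b c d) s → s.card ≤ H) ∧
    (∀ s : Finset α, HomogeneousSet (fun a b c d => F a b c d < 0) s → s.card ≤ H)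

/-- The signs of quadruples after each point of a sequence is replaced by a small copy of a
second sequence: `F` and `F'` are the sign functions of the two sequences and `G` is that of the
result, indexed by (point of the first, point of the second). -/
structure BlowUpSigns {α β : Type} [LT α] [LT β] (F : α → α → α → α → ℝ)
    (F' : β → β → β → β → ℝ) (G : α × β → α × β → α × β → α × β → ℝ) : Prop where
  distinct : ∀ a b c d u v w x, a < b → b < c → c < d →
    0 < F a b c d * G (a, u) (b, v) (c, w) (d, x)
  same : ∀ a u v w x, u < v → v < w → w < x →
    0 < F' u v w x * G (a, u) (a, v) (a, w) (a, x)
  aabc : ∀ a b c u v w x, a < b → b < c → u < v → 0 < G (a, u) (a, v) (b, w) (c, x)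
  abbc : ∀ a b c u v w x, a < b → b < c → v < w → G (a, u) (b, v) (b, w) (c, x) < 0
  abcc : ∀ a b c u v w x, a < b → b < c → w < x → 0 < G (a, u) (b, v) (c, w) (c, x)
  aabb : ∀ a b u v w x, a < b → u < v → w < x → 0 < G (a, u) (a, v) (b, w) (b, x)
  aaab : ∀ a b u v w x, a < b → u < v → v < w → G (a, u) (a, v) (a, w) (b, x) < 0
  abbb : ∀ a b u v w x, a < b → v < w → w < x → G (a, u) (b, v) (b, w) (b, x) < 0

/-- A homogeneous set that meets every fibre at most once, or that lies in one fibre, is no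
larger than the homogeneous sets of the factors. -/
theorem card_le_of_injOn_or_const {α β : Type} [LinearOrder α] [LinearOrder β]
    {A : α → α → α → α → Prop} {B : β → β → β → β → Prop}
    {R : α ×ₗ β → α ×ₗ β → α ×ₗ β → α ×ₗ β → Prop} {H : ℕ}
    (hA : ∀ s : Finset α, HomogeneousSet A s → s.card ≤ H)
    (hB : ∀ s : Finset β, HomogeneousSet B s → s.card ≤ H)
    (hRA : ∀ p q r s, (ofLex p).1 < (ofLex q).1 → (ofLex q).1 < (ofLex r).1 →
      (ofLex r).1 < (ofLex s).1 → R p q r s →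
        A (ofLex p).1 (ofLex q).1 (ofLex r).1 (ofLex s).1)
    (hRB : ∀ a u v w x, u < v → v < w → w < x →
      R (toLex (a, u)) (toLex (a, v)) (toLex (a, w)) (toLex (a, x)) → B u v w x)
    {s : Finset (α ×ₗ β)} (hs : HomogeneousSet R s)
    (h : Set.InjOn (fun p : α ×ₗ β => (ofLex p).1) s ∨ ∃ a, ∀ p ∈ s, (ofLex p).1 = a) :
    s.card ≤ H := by
  have hmono : ∀ p q : α ×ₗ β, (ofLex p).1 < (ofLex q).1 → p < q := fun p q h =>
    Prod.Lex.lt_iff.2 (Or.inl h)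
  rcases h with h | ⟨a, ha⟩
  · rw [← Finset.card_image_of_injOn h]
    refine hA _ ?_
    intro a ha b hb c hc d hd hab hbc hcd
    obtain ⟨p, hp, rfl⟩ := Finset.mem_image.1 ha
    obtain ⟨q, hq, rfl⟩ := Finset.mem_image.1 hb
    obtain ⟨r, hr, rfl⟩ := Finset.mem_image.1 hc
    obtain ⟨x, hx, rfl⟩ := Finset.mem_image.1 hd
    exact hRA p q r x hab hbc hcd
      (hs p hp q hq r hr x hx (hmono _ _ hab) (hmono _ _ hbc) (hmono _ _ hcd))
  · have hform : ∀ p ∈ s, p = toLex (a, (ofLex p).2) := by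
      intro p hp; rw [← ha p hp]; rfl
    have hinj : Set.InjOn (fun p : α ×ₗ β => (ofLex p).2) s := by
      intro p hp q hq hpq
      rw [hform p hp, hform q hq]
      simp only at hpq
      rw [hpq]
    rw [← Finset.card_image_of_injOn hinj]
    refine hB _ ?_
    have hmem : ∀ u ∈ s.image (fun p : α ×ₗ β => (ofLex p).2), toLex (a, u) ∈ s := by
      intro u hu
      obtain ⟨p, hp, rfl⟩ := Finset.mem_image.1 hu
      rw [← hform p hp]; exact hp
    have hlt : ∀ u v : β, u < v → (toLex (a, u) : α ×ₗ β) < toLex (a, v) := fun u v huv =>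
      Prod.Lex.lt_iff.2 (Or.inr ⟨rfl, huv⟩)
    intro u hu v hv w hw x hx huv hvw hwx
    exact hRB a u v w x huv hvw hwx (hs _ (hmem u hu) _ (hmem v hv) _ (hmem w hw) _ (hmem x hx)
      (hlt _ _ huv) (hlt _ _ hvw) (hlt _ _ hwx))

/-- Blowing up increases the sizes of homogeneous sets by at most two, while the number of points
is multiplied: once the least and the greatest point are removed, a homogeneous set lies in one
fibre or meets each fibre at most once. -/
theorem BlowUpSigns.homogeneousBound {α β : Type} [LinearOrder α] [LinearOrder β]
    {F : α → α → α → α → ℝ} {F' : β → β → β → β → ℝ}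
    {G : α × β → α × β → α × β → α × β → ℝ} (h : BlowUpSigns F F' G) {H : ℕ}
    (hF : HomogeneousBound F H) (hF' : HomogeneousBound F' H) :
    HomogeneousBound (α := α ×ₗ β)
      (fun p q r s => G (ofLex p) (ofLex q) (ofLex r) (ofLex s)) (H + 2) := by
  -- the set without its extreme points
  have trim : ∀ s : Finset (α ×ₗ β), ∀ hs : s.Nonempty,
      s.card ≤ ((s.erase (s.min' hs)).erase (s.max' hs)).card + 2 := by
    intro s hs
    have h1 := Finset.pred_card_le_card_erase (s := s) (a := s.min' hs)
    have h2 := Finset.pred_card_le_card_erase (s := s.erase (s.min' hs)) (a := s.max' hs)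
    omega
  have strict : ∀ s : Finset (α ×ₗ β), ∀ hs : s.Nonempty,
      ∀ p ∈ (s.erase (s.min' hs)).erase (s.max' hs), p ∈ s ∧ s.min' hs < p ∧ p < s.max' hs := by
    intro s hs p hp
    rw [Finset.mem_erase, Finset.mem_erase] at hp
    exact ⟨hp.2.2, lt_of_le_of_ne (s.min'_le p hp.2.2) (Ne.symm hp.2.1),
      lt_of_le_of_ne (s.le_max' p hp.2.2) hp.1⟩
  have snd_lt : ∀ p q : α ×ₗ β, p < q → (ofLex p).1 = (ofLex q).1 →
      (ofLex p).2 < (ofLex q).2 := by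
    intro p q hpq he
    rcases Prod.Lex.lt_iff.1 hpq with h1 | h1
    · exact absurd he h1.ne
    · exact h1.2
  have fst_le : ∀ p q : α ×ₗ β, p ≤ q → (ofLex p).1 ≤ (ofLex q).1 := fun p q hpq =>
    (Prod.Lex.monotone_fst p q hpq)
  have not_inj : ∀ s : Finset (α ×ₗ β), ¬ Set.InjOn (fun p : α ×ₗ β => (ofLex p).1) s →
      ∃ p ∈ s, ∃ q ∈ s, p < q ∧ (ofLex p).1 = (ofLex q).1 := by
    intro s hs
    simp only [Set.InjOn] at hs
    push Not at hs
    obtain ⟨p, hp, q, hq, he, hne⟩ := hs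
    rcases lt_or_gt_of_ne hne with h1 | h1
    · exact ⟨p, hp, q, hq, h1, he⟩
    · exact ⟨q, hq, p, hp, h1, he.symm⟩
  constructor
  · intro s hs
    rcases s.eq_empty_or_nonempty with rfl | hne
    · simp
    refine (trim s hne).trans (Nat.add_le_add_right ?_ 2)
    set s' := (s.erase (s.min' hne)).erase (s.max' hne) with hs'
    refine card_le_of_injOn_or_const hF.1 hF'.1
      (R := fun p q r s => 0 < G (ofLex p) (ofLex q) (ofLex r) (ofLex s))
      (fun p q r x h1 h2 h3 hG => (pos_iff_pos_of_mul_pos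
        (h.distinct _ _ _ _ (ofLex p).2 (ofLex q).2 (ofLex r).2 (ofLex x).2 h1 h2 h3)).2 hG)
      (fun a u v w x h1 h2 h3 hG => (pos_iff_pos_of_mul_pos (h.same a u v w x h1 h2 h3)).2 hG)
      (s := s') ?_ ?_
    · intro a ha b hb c hc d hd
      exact hs a (strict s hne a ha).1 b (strict s hne b hb).1 c (strict s hne c hc).1
        d (strict s hne d hd).1
    by_contra hcon
    rw [not_or] at hcon
    obtain ⟨hcon, hcon'⟩ := hcon
    obtain ⟨p, hp, q, hq, hpq, he⟩ := not_inj s' hcon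
    obtain ⟨hps, hmp, -⟩ := strict s hne p hp
    obtain ⟨hqs, -, hqM⟩ := strict s hne q hq
    have hG := hs _ (s.min'_mem hne) p hps q hqs _ (s.max'_mem hne) hmp hpq hqM
    have hlt := snd_lt p q hpq he
    have hle1 := fst_le _ _ hmp.le
    have hle2 := fst_le _ _ hqM.le
    set m := s.min' hne with hm
    set M := s.max' hne with hM
    have e1 : ofLex q = ((ofLex p).1, (ofLex q).2) := by rw [he]
    simp only at hG
    rcases hle1.lt_or_eq with h1 | h1
    · rcases hle2.lt_or_eq with h2 | h2
      · refine absurd hG (not_lt.2 (le_of_lt ?_))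
        have := h.abbc _ _ _ (ofLex m).2 (ofLex p).2 (ofLex q).2 (ofLex M).2 h1 (he ▸ h2) hlt
        rwa [← e1] at this
      · refine absurd hG (not_lt.2 (le_of_lt ?_))
        have := h.abbb _ _ (ofLex m).2 (ofLex p).2 (ofLex q).2 (ofLex M).2 h1 hlt
          (snd_lt _ _ hqM h2)
        have e2 : ofLex p = ((ofLex M).1, (ofLex p).2) := by rw [← h2, ← he]
        rw [← e1, he, h2] at this
        rwa [← e2] at this
    · rcases hle2.lt_or_eq with h2 | h2
      · refine absurd hG (not_lt.2 (le_of_lt ?_))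
        have := h.aaab _ _ (ofLex m).2 (ofLex p).2 (ofLex q).2 (ofLex M).2 (he ▸ h2)
          (snd_lt _ _ hmp h1) hlt
        have e2 : ofLex p = ((ofLex m).1, (ofLex p).2) := by rw [h1]
        rw [← e1, ← h1] at this
        rwa [← e2] at this
      · refine hcon' ⟨(ofLex m).1, fun x hx => ?_⟩
        obtain ⟨-, hx1, hx2⟩ := strict s hne x hx
        refine le_antisymm ((fst_le _ _ hx2.le).trans ?_) (fst_le _ _ hx1.le)
        rw [h1, he, h2]
  · intro s hs
    rcases s.eq_empty_or_nonempty with rfl | hne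
    · simp
    refine (trim s hne).trans (Nat.add_le_add_right ?_ 2)
    set s' := (s.erase (s.min' hne)).erase (s.max' hne) with hs'
    refine card_le_of_injOn_or_const hF.2 hF'.2
      (R := fun p q r s => G (ofLex p) (ofLex q) (ofLex r) (ofLex s) < 0)
      (fun p q r x h1 h2 h3 hG => (neg_iff_neg_of_mul_pos
        (h.distinct _ _ _ _ (ofLex p).2 (ofLex q).2 (ofLex r).2 (ofLex x).2 h1 h2 h3)).2 hG)
      (fun a u v w x h1 h2 h3 hG => (neg_iff_neg_of_mul_pos (h.same a u v w x h1 h2 h3)).2 hG)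
      (s := s') ?_ ?_
    · intro a ha b hb c hc d hd
      exact hs a (strict s hne a ha).1 b (strict s hne b hb).1 c (strict s hne c hc).1
        d (strict s hne d hd).1
    by_contra hcon
    rw [not_or] at hcon
    obtain ⟨hcon, hcon'⟩ := hcon
    obtain ⟨p, hp, q, hq, hpq, he⟩ := not_inj s' hcon
    obtain ⟨hps, hmp, -⟩ := strict s hne p hp
    obtain ⟨hqs, -, hqM⟩ := strict s hne q hq
    have hlt := snd_lt p q hpq he
    have e1 : ofLex q = ((ofLex p).1, (ofLex q).2) := by rw [he]
    have lt_of_fst : ∀ x y : α ×ₗ β, (ofLex x).1 < (ofLex y).1 → x < y := fun x y h =>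
      Prod.Lex.lt_iff.2 (Or.inl h)
    -- Two points on one side of the fibre of `p` and `q` form a positive quadruple with them.
    refine hcon' ⟨(ofLex p).1, fun x hx => ?_⟩
    obtain ⟨hxs, hmx, hxM⟩ := strict s hne x hx
    set m := s.min' hne with hm
    set M := s.max' hne with hM
    rcases lt_trichotomy (ofLex x).1 (ofLex p).1 with h1 | h1 | h1
    · exfalso
      have hG := hs m (s.min'_mem hne) x hxs p hps q hqs hmx (lt_of_fst _ _ h1) hpq
      simp only at hG
      refine absurd hG (not_lt.2 (le_of_lt ?_))
      rcases (fst_le _ _ hmx.le).lt_or_eq with h2 | h2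
      · have := h.abcc _ _ _ (ofLex m).2 (ofLex x).2 (ofLex p).2 (ofLex q).2 h2 h1 hlt
        rwa [← e1] at this
      · have := h.aabb _ _ (ofLex m).2 (ofLex x).2 (ofLex p).2 (ofLex q).2 h1
          (snd_lt _ _ hmx h2) hlt
        have e2 : ofLex x = ((ofLex m).1, (ofLex x).2) := by rw [h2]
        rw [← e1, ← h2] at this
        rwa [← e2] at this
    · exact h1
    · exfalso
      have hG := hs p hps q hqs x hxs M (s.max'_mem hne) hpq (lt_of_fst _ _ (he ▸ h1)) hxM
      simp only at hG
      refine absurd hG (not_lt.2 (le_of_lt ?_))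
      rcases (fst_le _ _ hxM.le).lt_or_eq with h2 | h2
      · have := h.aabc _ _ _ (ofLex p).2 (ofLex q).2 (ofLex x).2 (ofLex M).2 h1 h2 hlt
        rwa [← e1] at this
      · have := h.aabb _ _ (ofLex p).2 (ofLex q).2 (ofLex x).2 (ofLex M).2 h1 hlt
          (snd_lt _ _ hxM h2)
        have e2 : ofLex x = ((ofLex M).1, (ofLex x).2) := by rw [← h2]
        rw [← e1, h2] at this
        rwa [← e2] at this

/-! ### Blowing up points of a parabolic cylinder -/

/-- The form `vol` for the points `(t, t ^ 2, y)`; for increasing `t`, its sign is opposite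
to that of the third divided difference of `y` as a function of `t`. -/
def parabolicVol (t₁ t₂ t₃ t₄ y₁ y₂ y₃ y₄ : ℝ) : ℝ :=
  (t₃ - t₂) * (t₄ - t₂) * (t₄ - t₃) * y₁ - (t₃ - t₁) * (t₄ - t₁) * (t₄ - t₃) * y₂
    + (t₂ - t₁) * (t₄ - t₁) * (t₄ - t₂) * y₃ - (t₂ - t₁) * (t₃ - t₁) * (t₃ - t₂) * y₄

/-- A `3 × 3` determinant given by its rows. -/
def rowDet (a₁ a₂ a₃ b₁ b₂ b₃ c₁ c₂ c₃ : ℝ) : ℝ :=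
  a₁ * (b₂ * c₃ - b₃ * c₂) - a₂ * (b₁ * c₃ - b₃ * c₁) + a₃ * (b₁ * c₂ - b₂ * c₁)

theorem eventually_pos_of_eq_pow_mul {P G : ℝ → ℝ} (k : ℕ) (hG : Continuous G) (h0 : 0 < G 0)
    (h : ∀ r, P r = r ^ k * G r) : ∀ᶠ r in nhdsWithin 0 (Set.Ioi 0), 0 < P r := by
  have h1 : ∀ᶠ r in nhdsWithin (0 : ℝ) (Set.Ioi 0), 0 < G r :=
    (hG.tendsto 0).mono_left nhdsWithin_le_nhds |>.eventually (lt_mem_nhds h0)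
  filter_upwards [h1, self_mem_nhdsWithin] with r h2 h3
  rw [h]
  exact mul_pos (pow_pos h3 k) h2

theorem eventually_neg_of_eq_pow_mul {P G : ℝ → ℝ} (k : ℕ) (hG : Continuous G) (h0 : G 0 < 0)
    (h : ∀ r, P r = r ^ k * G r) : ∀ᶠ r in nhdsWithin 0 (Set.Ioi 0), P r < 0 := by
  filter_upwards [eventually_pos_of_eq_pow_mul (P := fun r => - P r) (G := fun r => - G r) k
    hG.neg (by linarith) (fun r => by rw [h]; ring)] with r hr
  linarith

/-- The first coordinate of the blow-up: a copy of `u` scaled by `r ^ 2`. -/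
def blowT (r a u : ℝ) : ℝ := a + r ^ 2 * u

/-- The height in the blow-up: the copy, scaled by `r ^ 4`, is sheared to have slope about
`-1 / r`, large compared with the slopes of the first sequence. -/
def blowY (r y u v : ℝ) : ℝ := y - r * u + r ^ 4 * v

section Signs

variable (a b c d ya yb yc yd u₁ u₂ u₃ u₄ v₁ v₂ v₃ v₄ : ℝ)

/-- `parabolicVol` of the blow-up, as a function of the scale `r`. -/
def blowVol (r : ℝ) : ℝ :=
  parabolicVol (blowT r a u₁) (blowT r b u₂) (blowT r c u₃) (blowT r d u₄)
    (blowY r ya u₁ v₁) (blowY r yb u₂ v₂) (blowY r yc u₃ v₃) (blowY r yd u₄ v₄)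

theorem blowVol_same (r : ℝ) : blowVol a a a a ya ya ya ya u₁ u₂ u₃ u₄ v₁ v₂ v₃ v₄ r
    = r ^ 10 * parabolicVol u₁ u₂ u₃ u₄ v₁ v₂ v₃ v₄ := by
  simp only [blowVol, parabolicVol, blowT, blowY]; ring

theorem continuous_blowVol : Continuous (blowVol a b c d ya yb yc yd u₁ u₂ u₃ u₄ v₁ v₂ v₃ v₄) := by
  unfold blowVol parabolicVol blowT blowY; fun_prop

theorem blowVol_zero : blowVol a b c d ya yb yc yd u₁ u₂ u₃ u₄ v₁ v₂ v₃ v₄ 0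
    = parabolicVol a b c d ya yb yc yd := by
  simp [blowVol, blowT, blowY]

theorem eventually_blowVol_aabc (hab : a < b) (hbc : b < c) (hu : u₁ < u₂) :
    ∀ᶠ r in nhdsWithin 0 (Set.Ioi 0),
      0 < blowVol a a b c ya ya yb yc u₁ u₂ u₃ u₄ v₁ v₂ v₃ v₄ r := by
  -- The origin is moved to the third point, and the first row is subtracted from the second.
  refine eventually_pos_of_eq_pow_mul 1 (G := fun r => - rowDet
    (blowT r a u₁ - blowT r b u₃) ((blowT r a u₁ - blowT r b u₃) ^ 2)
      (blowY r ya u₁ v₁ - blowY r yb u₃ v₃)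
    (r * (u₂ - u₁))
      (r * (u₂ - u₁) * ((blowT r a u₁ - blowT r b u₃) + (blowT r a u₂ - blowT r b u₃)))
      (- (u₂ - u₁) + r ^ 3 * (v₂ - v₁))
    (blowT r c u₄ - blowT r b u₃) ((blowT r c u₄ - blowT r b u₃) ^ 2)
      (blowY r yc u₄ v₄ - blowY r yb u₃ v₃)) ?_ ?_ ?_
  · unfold rowDet blowT blowY; fun_prop
  · have : 0 < (b - a) * (c - b) * (c - a) * (u₂ - u₁) :=
      mul_pos (mul_pos (mul_pos (by linarith) (by linarith)) (by linarith)) (by linarith)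
    simp [rowDet, blowT, blowY]
    linarith
  · intro r
    simp only [blowVol, parabolicVol, rowDet, blowT, blowY]; ring

theorem eventually_blowVol_abbc (hab : a < b) (hbc : b < c) (hu : u₂ < u₃) :
    ∀ᶠ r in nhdsWithin 0 (Set.Ioi 0),
      blowVol a b b c ya yb yb yc u₁ u₂ u₃ u₄ v₁ v₂ v₃ v₄ r < 0 := by
  refine eventually_neg_of_eq_pow_mul 1 (G := fun r => - rowDet
    (blowT r b u₂ - blowT r a u₁) ((blowT r b u₂ - blowT r a u₁) ^ 2)
      (blowY r yb u₂ v₂ - blowY r ya u₁ v₁)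
    (r * (u₃ - u₂))
      (r * (u₃ - u₂) * ((blowT r b u₂ - blowT r a u₁) + (blowT r b u₃ - blowT r a u₁)))
      (- (u₃ - u₂) + r ^ 3 * (v₃ - v₂))
    (blowT r c u₄ - blowT r a u₁) ((blowT r c u₄ - blowT r a u₁) ^ 2)
      (blowY r yc u₄ v₄ - blowY r ya u₁ v₁)) ?_ ?_ ?_
  · unfold rowDet blowT blowY; fun_prop
  · have : 0 < (b - a) * (c - b) * (c - a) * (u₃ - u₂) :=
      mul_pos (mul_pos (mul_pos (by linarith) (by linarith)) (by linarith)) (by linarith)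
    simp [rowDet, blowT, blowY]
    linarith
  · intro r
    simp only [blowVol, parabolicVol, rowDet, blowT, blowY]; ring

theorem eventually_blowVol_abcc (hab : a < b) (hbc : b < c) (hu : u₃ < u₄) :
    ∀ᶠ r in nhdsWithin 0 (Set.Ioi 0),
      0 < blowVol a b c c ya yb yc yc u₁ u₂ u₃ u₄ v₁ v₂ v₃ v₄ r := by
  refine eventually_pos_of_eq_pow_mul 1 (G := fun r => - rowDet
    (blowT r b u₂ - blowT r a u₁) ((blowT r b u₂ - blowT r a u₁) ^ 2)
      (blowY r yb u₂ v₂ - blowY r ya u₁ v₁)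
    (blowT r c u₃ - blowT r a u₁) ((blowT r c u₃ - blowT r a u₁) ^ 2)
      (blowY r yc u₃ v₃ - blowY r ya u₁ v₁)
    (r * (u₄ - u₃))
      (r * (u₄ - u₃) * ((blowT r c u₃ - blowT r a u₁) + (blowT r c u₄ - blowT r a u₁)))
      (- (u₄ - u₃) + r ^ 3 * (v₄ - v₃))) ?_ ?_ ?_
  · unfold rowDet blowT blowY; fun_prop
  · have : 0 < (b - a) * (c - b) * (c - a) * (u₄ - u₃) :=
      mul_pos (mul_pos (mul_pos (by linarith) (by linarith)) (by linarith)) (by linarith)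
    simp [rowDet, blowT, blowY]
    linarith
  · intro r
    simp only [blowVol, parabolicVol, rowDet, blowT, blowY]; ring

theorem eventually_blowVol_aabb (hab : a < b) (hu : u₁ < u₂) (hu' : u₃ < u₄) :
    ∀ᶠ r in nhdsWithin 0 (Set.Ioi 0),
      0 < blowVol a a b b ya ya yb yb u₁ u₂ u₃ u₄ v₁ v₂ v₃ v₄ r := by
  -- With the first point as origin, each of the two pairs gives a row divisible by `r`; a further
  -- factor `r` comes from the first two entries of the row of the pair at the origin.
  refine eventually_pos_of_eq_pow_mul 3 (G := fun r => -
    ((u₂ - u₁) * ((blowT r b u₃ - blowT r a u₁) ^ 2 * (- (u₄ - u₃) + r ^ 3 * (v₄ - v₃))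
        - (blowY r yb u₃ v₃ - blowY r ya u₁ v₁) * (r * ((u₄ - u₃) *
          ((blowT r b u₃ - blowT r a u₁) + (blowT r b u₄ - blowT r a u₁)))))
      - r ^ 2 * (u₂ - u₁) ^ 2 * ((blowT r b u₃ - blowT r a u₁) *
          (- (u₄ - u₃) + r ^ 3 * (v₄ - v₃))
        - (blowY r yb u₃ v₃ - blowY r ya u₁ v₁) * (r * (u₄ - u₃)))
      + (- (u₂ - u₁) + r ^ 3 * (v₂ - v₁)) * ((blowT r b u₃ - blowT r a u₁) * ((u₄ - u₃) *
          ((blowT r b u₃ - blowT r a u₁) + (blowT r b u₄ - blowT r a u₁)))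
        - (blowT r b u₃ - blowT r a u₁) ^ 2 * (u₄ - u₃)))) ?_ ?_ ?_
  · unfold blowT blowY; fun_prop
  · have : 0 < (b - a) ^ 2 * ((u₂ - u₁) * (u₄ - u₃)) :=
      mul_pos (pow_pos (by linarith) 2) (mul_pos (by linarith) (by linarith))
    simp [blowT, blowY]
    linarith
  · intro r
    simp only [blowVol, parabolicVol, blowT, blowY]; ring

theorem eventually_blowVol_aaab (hab : a < b) (hu : u₁ < u₂) (hu' : u₂ < u₃) :
    ∀ᶠ r in nhdsWithin 0 (Set.Ioi 0),
      blowVol a a a b ya ya ya yb u₁ u₂ u₃ u₄ v₁ v₂ v₃ v₄ r < 0 := by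
  -- Two nearby points give rows that are, up to `r ^ 3`, multiples of `(r, 0, -1)`, so that all
  -- `2 × 2` minors of these rows are small; the determinant is expanded along the row of `b`.
  refine eventually_neg_of_eq_pow_mul 5 (G := fun r => -
    ((blowT r b u₄ - blowT r a u₁) * ((u₂ - u₁) * (u₃ - u₁) * (u₃ - u₂)
        + r ^ 3 * ((u₂ - u₁) ^ 2 * (v₃ - v₁) - (v₂ - v₁) * (u₃ - u₁) ^ 2))
      - (blowT r b u₄ - blowT r a u₁) ^ 2 * (r * ((u₂ - u₁) * (v₃ - v₁)
        - (v₂ - v₁) * (u₃ - u₁)))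
      + (blowY r yb u₄ v₄ - blowY r ya u₁ v₁) * (r * ((u₂ - u₁) * (u₃ - u₁) * (u₃ - u₂)))))
    ?_ ?_ ?_
  · unfold blowT blowY; fun_prop
  · have : 0 < (b - a) * ((u₂ - u₁) * (u₃ - u₁) * (u₃ - u₂)) :=
      mul_pos (by linarith) (mul_pos (mul_pos (by linarith) (by linarith)) (by linarith))
    simp [blowT, blowY]
    linarith
  · intro r
    simp only [blowVol, parabolicVol, blowT, blowY]; ring

theorem eventually_blowVol_abbb (hab : a < b) (hu : u₂ < u₃) (hu' : u₃ < u₄) :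
    ∀ᶠ r in nhdsWithin 0 (Set.Ioi 0),
      blowVol a b b b ya yb yb yb u₁ u₂ u₃ u₄ v₁ v₂ v₃ v₄ r < 0 := by
  -- As for `aaab`, with the second point as origin.
  refine eventually_neg_of_eq_pow_mul 5 (G := fun r =>
    ((blowT r a u₁ - blowT r b u₂) * ((u₃ - u₂) * (u₄ - u₂) * (u₄ - u₃)
        + r ^ 3 * ((u₃ - u₂) ^ 2 * (v₄ - v₂) - (v₃ - v₂) * (u₄ - u₂) ^ 2))
      - (blowT r a u₁ - blowT r b u₂) ^ 2 * (r * ((u₃ - u₂) * (v₄ - v₂)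
        - (v₃ - v₂) * (u₄ - u₂)))
      + (blowY r ya u₁ v₁ - blowY r yb u₂ v₂) * (r * ((u₃ - u₂) * (u₄ - u₂) * (u₄ - u₃)))))
    ?_ ?_ ?_
  · unfold blowT blowY; fun_prop
  · have : 0 < (b - a) * ((u₃ - u₂) * (u₄ - u₂) * (u₄ - u₃)) :=
      mul_pos (by linarith) (mul_pos (mul_pos (by linarith) (by linarith)) (by linarith))
    simp [blowT, blowY]
    linarith
  · intro r
    simp only [blowVol, parabolicVol, blowT, blowY]; ring

end Signs

theorem BlowUpSigns.ne_zero {α β : Type} [LinearOrder α] [LinearOrder β]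
    {F : α → α → α → α → ℝ} {F' : β → β → β → β → ℝ}
    {G : α × β → α × β → α × β → α × β → ℝ} (h : BlowUpSigns F F' G) {p q r s : α ×ₗ β}
    (hpq : p < q) (hqr : q < r) (hrs : r < s) :
    G (ofLex p) (ofLex q) (ofLex r) (ofLex s) ≠ 0 := by
  obtain ⟨⟨a, u⟩, rfl⟩ := toLex.surjective p
  obtain ⟨⟨b, v⟩, rfl⟩ := toLex.surjective q
  obtain ⟨⟨c, w⟩, rfl⟩ := toLex.surjective r
  obtain ⟨⟨d, x⟩, rfl⟩ := toLex.surjective s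
  rw [Prod.Lex.toLex_lt_toLex] at hpq hqr hrs
  simp only [ofLex_toLex] at *
  rcases hpq with h1 | ⟨rfl, h1⟩ <;> rcases hqr with h2 | ⟨rfl, h2⟩ <;>
    rcases hrs with h3 | ⟨rfl, h3⟩
  · exact right_ne_zero_of_mul (h.distinct a b c d u v w x h1 h2 h3).ne'
  · exact (h.abcc a b c u v w x h1 h2 h3).ne'
  · exact (h.abbc a b d u v w x h1 h3 h2).ne
  · exact (h.abbb a b u v w x h1 h2 h3).ne
  · exact (h.aabc a c d u v w x h2 h3 h1).ne'
  · exact (h.aabb a c u v w x h2 h1 h3).ne'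
  · exact (h.aaab a d u v w x h3 h1 h2).ne
  · exact right_ne_zero_of_mul (h.same a u v w x h1 h2 h3).ne'

/-- The points `(t a, t a ^ 2, y a)`, with `t` increasing, span no degenerate tetrahedron, and
no more than `H` of them form tetrahedra of a single orientation. -/
structure SmallHomogeneous {α : Type} [LinearOrder α] (t y : α → ℝ) (H : ℕ) : Prop where
  strictMono : StrictMono t
  ne_zero : ∀ a b c d, a < b → b < c → c < d →
    parabolicVol (t a) (t b) (t c) (t d) (y a) (y b) (y c) (y d) ≠ 0
  bound : HomogeneousBound
    (fun a b c d => parabolicVol (t a) (t b) (t c) (t d) (y a) (y b) (y c) (y d)) H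

theorem SmallHomogeneous.exists_blowUp {α β : Type} [LinearOrder α] [LinearOrder β] [Finite α]
    [Finite β] {t y : α → ℝ} {t' y' : β → ℝ} {H : ℕ} (h : SmallHomogeneous t y H)
    (h' : SmallHomogeneous t' y' H) : ∃ T Y : α ×ₗ β → ℝ, SmallHomogeneous T Y (H + 2) := by
  let l : Filter ℝ := nhdsWithin 0 (Set.Ioi 0)
  let G : ℝ → α × β → α × β → α × β → α × β → ℝ := fun r p q s x =>
    blowVol (t p.1) (t q.1) (t s.1) (t x.1) (y p.1) (y q.1) (y s.1) (y x.1)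
      (t' p.2) (t' q.2) (t' s.2) (t' x.2) (y' p.2) (y' q.2) (y' s.2) (y' x.2) r
  have hpos : ∀ᶠ r in l, 0 < r := self_mem_nhdsWithin
  have e1 : ∀ᶠ r in l, ∀ (a b c d : α) (u v w x : β), a < b → b < c → c < d →
      0 < parabolicVol (t a) (t b) (t c) (t d) (y a) (y b) (y c) (y d)
        * G r (a, u) (b, v) (c, w) (d, x) := by
    simp only [Filter.eventually_all]
    intro a b c d u v w x hab hbc hcd
    have hne := h.ne_zero a b c d hab hbc hcd
    refine eventually_pos_of_eq_pow_mul 0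
      (continuous_const.mul (continuous_blowVol _ _ _ _ _ _ _ _ _ _ _ _ _ _ _ _)) ?_
      (fun r => (one_mul _).symm)
    rw [Pi.mul_apply, blowVol_zero]
    exact mul_self_pos.2 hne
  have e2 : ∀ᶠ r in l, ∀ (a b c : α) (u v w x : β), a < b → b < c → u < v →
      0 < G r (a, u) (a, v) (b, w) (c, x) := by
    simp only [Filter.eventually_all]
    intro a b c u v w x hab hbc huv
    exact eventually_blowVol_aabc _ _ _ _ _ _ _ _ _ _ _ _ _ _ (h.strictMono hab)
      (h.strictMono hbc) (h'.strictMono huv)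
  have e3 : ∀ᶠ r in l, ∀ (a b c : α) (u v w x : β), a < b → b < c → v < w →
      G r (a, u) (b, v) (b, w) (c, x) < 0 := by
    simp only [Filter.eventually_all]
    intro a b c u v w x hab hbc huv
    exact eventually_blowVol_abbc _ _ _ _ _ _ _ _ _ _ _ _ _ _ (h.strictMono hab)
      (h.strictMono hbc) (h'.strictMono huv)
  have e4 : ∀ᶠ r in l, ∀ (a b c : α) (u v w x : β), a < b → b < c → w < x →
      0 < G r (a, u) (b, v) (c, w) (c, x) := by
    simp only [Filter.eventually_all]
    intro a b c u v w x hab hbc huv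
    exact eventually_blowVol_abcc _ _ _ _ _ _ _ _ _ _ _ _ _ _ (h.strictMono hab)
      (h.strictMono hbc) (h'.strictMono huv)
  have e5 : ∀ᶠ r in l, ∀ (a b : α) (u v w x : β), a < b → u < v → w < x →
      0 < G r (a, u) (a, v) (b, w) (b, x) := by
    simp only [Filter.eventually_all]
    intro a b u v w x hab huv hwx
    exact eventually_blowVol_aabb _ _ _ _ _ _ _ _ _ _ _ _ (h.strictMono hab)
      (h'.strictMono huv) (h'.strictMono hwx)
  have e6 : ∀ᶠ r in l, ∀ (a b : α) (u v w x : β), a < b → u < v → v < w →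
      G r (a, u) (a, v) (a, w) (b, x) < 0 := by
    simp only [Filter.eventually_all]
    intro a b u v w x hab huv hwx
    exact eventually_blowVol_aaab _ _ _ _ _ _ _ _ _ _ _ _ (h.strictMono hab)
      (h'.strictMono huv) (h'.strictMono hwx)
  have e7 : ∀ᶠ r in l, ∀ (a b : α) (u v w x : β), a < b → v < w → w < x →
      G r (a, u) (b, v) (b, w) (b, x) < 0 := by
    simp only [Filter.eventually_all]
    intro a b u v w x hab huv hwx
    exact eventually_blowVol_abbb _ _ _ _ _ _ _ _ _ _ _ _ (h.strictMono hab)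
      (h'.strictMono huv) (h'.strictMono hwx)
  have e8 : ∀ᶠ r in l, ∀ (a b : α) (u v : β), a < b →
      0 < blowT r (t b) (t' v) - blowT r (t a) (t' u) := by
    simp only [Filter.eventually_all]
    intro a b u v hab
    refine eventually_pos_of_eq_pow_mul 0 (by unfold blowT; fun_prop) ?_
      (fun r => (one_mul _).symm)
    simpa [blowT] using h.strictMono hab
  obtain ⟨r, h0, h1, h2, h3, h4, h5, h6, h7, h8⟩ := (hpos.and <| e1.and <| e2.and <| e3.and <|
    e4.and <| e5.and <| e6.and <| e7.and e8).exists
  have hG : BlowUpSigns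
      (fun a b c d => parabolicVol (t a) (t b) (t c) (t d) (y a) (y b) (y c) (y d))
      (fun a b c d => parabolicVol (t' a) (t' b) (t' c) (t' d) (y' a) (y' b) (y' c) (y' d))
      (G r) := by
    refine ⟨h1, ?_, h2, h3, h4, h5, h6, h7⟩
    intro a u v w x huv hvw hwx
    have hne := h'.ne_zero u v w x huv hvw hwx
    simp only [G, blowVol_same]
    rw [mul_left_comm]
    exact mul_pos (pow_pos h0 _) (mul_self_pos.2 hne)
  refine ⟨fun p => blowT r (t (ofLex p).1) (t' (ofLex p).2),
    fun p => blowY r (y (ofLex p).1) (t' (ofLex p).2) (y' (ofLex p).2), ?_, ?_, ?_⟩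
  · intro p q hpq
    rcases Prod.Lex.lt_iff.1 hpq with hlt | ⟨he, hlt⟩
    · exact sub_pos.1 (h8 _ _ _ _ hlt)
    · have := mul_lt_mul_of_pos_left (h'.strictMono hlt) (pow_pos h0 2)
      simp only [blowT, he]
      linarith
  · intro p q s x hpq hqs hsx
    exact hG.ne_zero hpq hqs hsx
  · exact hG.homogeneousBound h.bound h'.bound

theorem SmallHomogeneous.comp {α β : Type} [LinearOrder α] [LinearOrder β] {t y : α → ℝ}
    {H : ℕ} (h : SmallHomogeneous t y H) {e : β → α} (he : StrictMono e) :
    SmallHomogeneous (t ∘ e) (y ∘ e) H := by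
  classical
  have key : ∀ R : α → α → α → α → Prop, (∀ s : Finset α, HomogeneousSet R s → s.card ≤ H) →
      ∀ s : Finset β, HomogeneousSet (fun a b c d => R (e a) (e b) (e c) (e d)) s →
        s.card ≤ H := by
    intro R hR s hs
    rw [← Finset.card_image_of_injective s he.injective]
    refine hR _ ?_
    intro a ha b hb c hc d hd
    obtain ⟨a', ha', rfl⟩ := Finset.mem_image.1 ha
    obtain ⟨b', hb', rfl⟩ := Finset.mem_image.1 hb
    obtain ⟨c', hc', rfl⟩ := Finset.mem_image.1 hc
    obtain ⟨d', hd', rfl⟩ := Finset.mem_image.1 hd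
    rw [he.lt_iff_lt, he.lt_iff_lt, he.lt_iff_lt]
    exact hs a' ha' b' hb' c' hc' d' hd'
  exact ⟨h.strictMono.comp he, fun a b c d hab hbc hcd => h.ne_zero _ _ _ _ (he hab) (he hbc)
    (he hcd), key _ h.bound.1, key _ h.bound.2⟩

/-- Squaring the number of points repeatedly gives doubly exponentially many points. -/
theorem exists_smallHomogeneous (q : ℕ) :
    ∃ t y : Fin (2 ^ 2 ^ q) → ℝ, SmallHomogeneous t y (2 * q + 2) := by
  induction q with
  | zero =>
    refine ⟨fun i => (i : ℕ), fun _ => 0, ?_, ?_, ?_, ?_⟩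
    · intro a b hab
      exact Nat.cast_lt.2 hab
    · intro a b c d hab hbc hcd
      have := d.2
      simp only [pow_zero, pow_one] at this
      omega
    · intro s _; simpa using s.card_le_univ
    · intro s _; simpa using s.card_le_univ
  | succ q ih =>
    obtain ⟨t, y, h⟩ := ih
    obtain ⟨T, Y, hT⟩ := h.exists_blowUp h
    have hcard : Fintype.card (Fin (2 ^ 2 ^ q) ×ₗ Fin (2 ^ 2 ^ q)) = 2 ^ 2 ^ (q + 1) := by
      simp only [Fintype.card_lex, Fintype.card_prod, Fintype.card_fin]
      rw [← pow_add]; congr 1; ring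
    let e := Fintype.orderIsoFinOfCardEq _ hcard
    exact ⟨T ∘ e, Y ∘ e, hT.comp e.strictMono⟩

/-! ### Admissible sequences on the parabolic cylinder -/

/-- The point of the cylinder over the parabola `(t, t ^ 2)` at height `y`. -/
def cylinderPoint (t y : ℝ) : Fin 3 → ℝ := ![t, t ^ 2, y]

theorem orient_cylinderPoint (t₁ t₂ t₃ y₁ y₂ y₃ : ℝ) :
    orient (planeProj (cylinderPoint t₁ y₁)) (planeProj (cylinderPoint t₂ y₂))
      (planeProj (cylinderPoint t₃ y₃)) = (t₂ - t₁) * (t₃ - t₁) * (t₃ - t₂) := by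
  simp [orient, planeProj, cylinderPoint]; ring

theorem vol_cylinderPoint (t₁ t₂ t₃ t₄ y₁ y₂ y₃ y₄ : ℝ) :
    vol (cylinderPoint t₁ y₁) (cylinderPoint t₂ y₂) (cylinderPoint t₃ y₃) (cylinderPoint t₄ y₄)
      = parabolicVol t₁ t₂ t₃ t₄ y₁ y₂ y₃ y₄ := by
  simp only [vol, orient_cylinderPoint]
  simp [cylinderPoint, parabolicVol]

/-- The weight of the first point in an affine dependence of four points vanishes when the
tetrahedron is not degenerate: the linear form `parabolicVol · t₂ t₃ t₄ · y₂ y₃ y₄` vanishes on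
the other three points. -/
theorem weight_eq_zero {t₁ t₂ t₃ t₄ y₁ y₂ y₃ y₄ w₁ w₂ w₃ w₄ : ℝ}
    (hD : parabolicVol t₁ t₂ t₃ t₄ y₁ y₂ y₃ y₄ ≠ 0) (h : w₁ + w₂ + w₃ + w₄ = 0)
    (h0 : w₁ * t₁ + w₂ * t₂ + w₃ * t₃ + w₄ * t₄ = 0)
    (h1 : w₁ * t₁ ^ 2 + w₂ * t₂ ^ 2 + w₃ * t₃ ^ 2 + w₄ * t₄ ^ 2 = 0)
    (h2 : w₁ * y₁ + w₂ * y₂ + w₃ * y₃ + w₄ * y₄ = 0) : w₁ = 0 := by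
  have : parabolicVol t₁ t₂ t₃ t₄ y₁ y₂ y₃ y₄ * w₁ = 0 := by
    unfold parabolicVol
    linear_combination (-y₂ * (t₄ - t₃) * (t₃ * t₄) + y₃ * (t₄ - t₂) * (t₂ * t₄)
        - y₄ * (t₃ - t₂) * (t₂ * t₃)) * h
      + (y₂ * (t₄ - t₃) * (t₃ + t₄) - y₃ * (t₄ - t₂) * (t₂ + t₄)
        + y₄ * (t₃ - t₂) * (t₂ + t₃)) * h0
      + (-y₂ * (t₄ - t₃) + y₃ * (t₄ - t₂) - y₄ * (t₃ - t₂)) * h1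
      + (t₃ - t₂) * (t₄ - t₂) * (t₄ - t₃) * h2
  exact (mul_eq_zero.1 this).resolve_left hD

theorem inGeneralPosition_of_ne_zero {N : ℕ} (hN : 4 ≤ N) {t y : Fin N → ℝ}
    (h : ∀ a b c d, a < b → b < c → c < d →
      parabolicVol (t a) (t b) (t c) (t d) (y a) (y b) (y c) (y d) ≠ 0) :
    InGeneralPosition fun i => cylinderPoint (t i) (y i) := by
  intro s hs
  obtain ⟨s', hss', hs'⟩ := Finset.exists_superset_card_eq hs (by simpa using hN)
  suffices H : AffineIndependent ℝ (fun i : s' => cylinderPoint (t i) (y i)) from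
    H.comp_embedding ⟨fun i : s => (⟨i, hss' i.2⟩ : s'), fun a b hab =>
      Subtype.ext (congrArg (fun i : s' => (i : Fin N)) hab)⟩
  let e := s'.orderIsoOfFin hs'
  rw [← affineIndependent_equiv e.toEquiv, affineIndependent_iff]
  intro S w hw hwp
  -- Weights on a part of the four points are extended by zero.
  let W : Fin 4 → ℝ := fun i => if i ∈ S then w i else 0
  have hD := h (e 0) (e 1) (e 2) (e 3) (e.strictMono (by decide)) (e.strictMono (by decide))
    (e.strictMono (by decide))
  have ext : ∀ f : Fin 4 → ℝ, ∑ i ∈ S, w i * f i = 0 →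
      W 0 * f 0 + W 1 * f 1 + W 2 * f 2 + W 3 * f 3 = 0 := by
    intro f hf
    rw [← Fin.sum_univ_four (fun i => W i * f i), ← hf]
    simp [W, ite_mul, Finset.sum_ite_mem]
  have hw' := ext (fun _ => 1) (by simpa using hw)
  simp only [mul_one] at hw'
  have coord : ∀ k : Fin 3, ∑ i ∈ S, w i * cylinderPoint (t (e i)) (y (e i)) k = 0 := by
    intro k
    have := congrFun hwp k
    simpa [Finset.sum_apply] using this
  have h0 := ext (fun i => t (e i)) (by simpa [cylinderPoint] using coord 0)
  have h1 := ext (fun i => t (e i) ^ 2) (by simpa [cylinderPoint] using coord 1)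
  have h2 := ext (fun i => y (e i)) (by simpa [cylinderPoint] using coord 2)
  have swap₁ : ∀ t₁ t₂ t₃ t₄ y₁ y₂ y₃ y₄ : ℝ, parabolicVol t₂ t₁ t₃ t₄ y₂ y₁ y₃ y₄
      = - parabolicVol t₁ t₂ t₃ t₄ y₁ y₂ y₃ y₄ := by
    intros; unfold parabolicVol; ring
  have swap₂ : ∀ t₁ t₂ t₃ t₄ y₁ y₂ y₃ y₄ : ℝ, parabolicVol t₃ t₂ t₁ t₄ y₃ y₂ y₁ y₄
      = - parabolicVol t₁ t₂ t₃ t₄ y₁ y₂ y₃ y₄ := by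
    intros; unfold parabolicVol; ring
  have swap₃ : ∀ t₁ t₂ t₃ t₄ y₁ y₂ y₃ y₄ : ℝ, parabolicVol t₄ t₂ t₃ t₁ y₄ y₂ y₃ y₁
      = - parabolicVol t₁ t₂ t₃ t₄ y₁ y₂ y₃ y₄ := by
    intros; unfold parabolicVol; ring
  have hW : ∀ i, W i = 0 := by
    intro i
    fin_cases i
    · exact weight_eq_zero hD hw' h0 h1 h2
    · refine weight_eq_zero (w₁ := W 1) (w₂ := W 0) (w₃ := W 2) (w₄ := W 3)
        (by rw [swap₁]; exact neg_ne_zero.2 hD) ?_ ?_ ?_ ?_ <;> linarith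
    · refine weight_eq_zero (w₁ := W 2) (w₂ := W 1) (w₃ := W 0) (w₄ := W 3)
        (by rw [swap₂]; exact neg_ne_zero.2 hD) ?_ ?_ ?_ ?_ <;> linarith
    · refine weight_eq_zero (w₁ := W 3) (w₂ := W 1) (w₃ := W 2) (w₄ := W 0)
        (by rw [swap₃]; exact neg_ne_zero.2 hD) ?_ ?_ ?_ ?_ <;> linarith
  intro i hi
  simpa [W, hi] using hW i

theorem isConvexPolygon_parabola {N : ℕ} {t y : Fin N → ℝ} (ht : StrictMono t) :
    IsConvexPolygon fun i => planeProj (cylinderPoint (t i) (y i)) := by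
  have hinj : Function.Injective fun i => planeProj (cylinderPoint (t i) (y i)) := by
    intro i j hij
    have := congrFun hij 0
    simp [planeProj, cylinderPoint] at this
    exact ht.injective this
  refine ⟨hinj, ?_⟩
  intro i j k hji hji' hki hki'
  obtain ⟨n, rfl⟩ : ∃ n, N = n + 1 := ⟨N - 1, by have := i.2; omega⟩
  -- The chord of the last and the first point runs backwards above the parabola; the other
  -- edges run forwards below it.
  suffices H : i ≠ finRotate (n + 1) i ∧ ∀ m, m ≠ i → m ≠ finRotate (n + 1) i →
      0 < (t (finRotate (n + 1) i) - t i) * (t m - t i) * (t m - t (finRotate (n + 1) i)) by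
    rw [sSameSide_iff_orient_mul_pos (fun he => H.1 (hinj he)), orient_cylinderPoint,
      orient_cylinderPoint]
    exact mul_pos (H.2 j hji hji') (H.2 k hki hki')
  rcases Nat.lt_or_ge i n with hi | hi
  · have hrot : finRotate (n + 1) i = ⟨i + 1, by omega⟩ := finRotate_of_lt hi
    rw [hrot]
    have hlt : i < ⟨i + 1, by omega⟩ := Fin.lt_def.2 (Nat.lt_succ_self _)
    refine ⟨hlt.ne, fun m h1 h2 => ?_⟩
    have h3 := sub_pos.2 (ht hlt)
    rcases lt_or_gt_of_ne h1 with h4 | h4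
    · exact mul_pos_of_neg_of_neg (mul_neg_of_pos_of_neg h3 (sub_neg.2 (ht h4)))
        (sub_neg.2 (ht (h4.trans hlt)))
    · have h5 : (⟨i + 1, by omega⟩ : Fin (n + 1)) < m :=
        lt_of_le_of_ne (Fin.le_def.2 (Nat.succ_le_of_lt h4)) (Ne.symm h2)
      exact mul_pos (mul_pos h3 (sub_pos.2 (ht h4))) (sub_pos.2 (ht h5))
  · obtain rfl : i = Fin.last n := Fin.ext (by have := i.2; simp; omega)
    rw [finRotate_last]
    have hlt : 0 < Fin.last n :=
      lt_of_le_of_ne (Fin.zero_le _) (fun h0 => hji (by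
        have : n = 0 := by simpa using (congrArg Fin.val h0).symm
        ext; have := j.2; simp; omega))
    refine ⟨hlt.ne', fun m h1 h2 => ?_⟩
    have h3 : m < Fin.last n := lt_of_le_of_ne (Fin.le_last _) h1
    have h4 : 0 < m := lt_of_le_of_ne (Fin.zero_le _) (Ne.symm h2)
    exact mul_pos (mul_pos_of_neg_of_neg (sub_neg.2 (ht hlt)) (sub_neg.2 (ht h3)))
      (sub_pos.2 (ht h4))

theorem InGeneralPosition.comp {N M : ℕ} {x : Fin M → Fin 3 → ℝ} (h : InGeneralPosition x)
    (e : Fin N ↪ Fin M) : InGeneralPosition (x ∘ e) := by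
  intro s hs
  exact (h (s.map e) (by simpa using hs)).comp_embedding
    ⟨fun i : s => (⟨e i, Finset.mem_map_of_mem e i.2⟩ : {a // a ∈ s.map e}), fun a b hab =>
      Subtype.ext (e.injective (congrArg Subtype.val hab))⟩

/-- Initial parts of the iterated blow-up force no homogeneous subsequence of `k` terms. The
alternative `N < k` covers the trivial bound; `1 ≤ q` makes the ambient sequence long
enough for general position. -/
theorem not_forcesAB {N k q : ℕ} (hq : 1 ≤ q) (hN : N ≤ 2 ^ 2 ^ q)
    (hk : 2 * q + 2 < k ∨ N < k) : ¬ ForcesAB N k := by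
  intro hf
  obtain ⟨t, y, h⟩ := exists_smallHomogeneous q
  have h4 : 4 ≤ 2 ^ 2 ^ q := by
    calc 4 = 2 ^ 2 ^ 1 := by norm_num
      _ ≤ 2 ^ 2 ^ q := by gcongr <;> norm_num
  let e := Fin.castLEEmb hN
  have he : StrictMono e := fun a b hab => hab
  have h' := h.comp he
  obtain ⟨i, hi, hom⟩ := hf _ ((inGeneralPosition_of_ne_zero h4 h.ne_zero).comp e)
    (isConvexPolygon_parabola h'.strictMono)
  rcases hk with hk | hk
  · have above : ∀ r s u v : Fin k, r < s → s < u → u < v →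
        (IsAbove (cylinderPoint (t (e (i r))) (y (e (i r))))
            (cylinderPoint (t (e (i u))) (y (e (i u))))
            (cylinderPoint (t (e (i s))) (y (e (i s))))
            (cylinderPoint (t (e (i v))) (y (e (i v)))) ↔
          0 < parabolicVol (t (e (i r))) (t (e (i s))) (t (e (i u))) (t (e (i v)))
            (y (e (i r))) (y (e (i s))) (y (e (i u))) (y (e (i v)))) := by
      intro r s u v hrs hsu huv
      have m : StrictMono (t ∘ e ∘ i) := h'.strictMono.comp hi
      have a1 := sub_pos.2 (m hrs)
      have a2 := sub_pos.2 (m hsu)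
      have a3 := sub_pos.2 (m huv)
      have a4 := sub_pos.2 (m (hrs.trans hsu))
      have a5 := sub_pos.2 (m (hsu.trans huv))
      have a6 := sub_pos.2 (m (hrs.trans (hsu.trans huv)))
      rw [isAbove_iff_vol_pos, vol_cylinderPoint] <;> rw [orient_cylinderPoint]
      · exact mul_pos (mul_pos a2 a5) a3
      · exact mul_pos (mul_pos a4 a6) a3
      · exact mul_pos (mul_pos a1 a6) a5
      · exact mul_pos (mul_pos a1 a4) a2
    have hb := h.comp (he.comp hi)
    have hcard : (Finset.univ : Finset (Fin k)).card = k := by simp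
    rcases hom with hom | hom
    · have := hb.bound.1 Finset.univ (fun a _ b _ c _ d _ hab hbc hcd =>
        (above a b c d hab hbc hcd).1 (hom a b c d hab hbc hcd))
      omega
    · have := hb.bound.2 Finset.univ (fun a _ b _ c _ d _ hab hbc hcd =>
        lt_of_le_of_ne (not_lt.1 ((above a b c d hab hbc hcd).not.1 (hom a b c d hab hbc hcd)))
          (hb.ne_zero a b c d hab hbc hcd))
      omega
  · have := Fintype.card_le_of_injective i hi.injective
    simp at this
    omega

/-! ### The bounds -/

theorem theorem1 :
    ∃ c C : ℝ, 0 < c ∧ 0 < C ∧ ∀ k : ℕ, 4 ≤ k →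
      IsLeast {N : ℕ | ForcesAB N k} (AB k) ∧
      (2 : ℝ) ^ ((2 : ℝ) ^ (c * (k : ℝ))) ≤ (AB k : ℝ) ∧
      (AB k : ℝ) ≤ (2 : ℝ) ^ ((2 : ℝ) ^ (C * (k : ℝ))) := by
  refine ⟨1 / 10, 2, by norm_num, by norm_num, fun k hk => ?_⟩
  have hpow : ∀ m : ℕ, (2 : ℝ) ^ ((2 : ℝ) ^ (m : ℝ)) = ((2 ^ 2 ^ m : ℕ) : ℝ) := by
    intro m
    rw [Real.rpow_natCast, show ((2 : ℝ) ^ m) = ((2 ^ m : ℕ) : ℝ) by push_cast; rfl,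
      Real.rpow_natCast]
    push_cast; rfl
  obtain ⟨n, rfl⟩ : ∃ n, k = n + 3 := ⟨k - 3, by omega⟩
  have hmem : 2 ^ 2 ^ (2 * n) + 1 ∈ {N : ℕ | ForcesAB N (n + 3)} :=
    forcesAB_of_lt (Nat.lt_succ_self _)
  have hAB : ForcesAB (AB (n + 3)) (n + 3) := Nat.sInf_mem ⟨_, hmem⟩
  refine ⟨⟨hAB, fun N hN => Nat.sInf_le hN⟩, ?_, ?_⟩
  · -- It suffices to bound `AB` below by `2 ^ 2 ^ q` for a natural number `q ≥ (n + 3) / 10`.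
    have low : ∀ q : ℕ, n + 3 ≤ 10 * q → 2 ^ 2 ^ q ≤ AB (n + 3) →
        (2 : ℝ) ^ ((2 : ℝ) ^ ((1 / 10 : ℝ) * ((n + 3 : ℕ) : ℝ))) ≤ (AB (n + 3) : ℝ) := by
      intro q hq h
      have hq' : ((n + 3 : ℕ) : ℝ) ≤ 10 * q := by exact_mod_cast hq
      calc (2 : ℝ) ^ ((2 : ℝ) ^ ((1 / 10 : ℝ) * ((n + 3 : ℕ) : ℝ)))
          ≤ (2 : ℝ) ^ ((2 : ℝ) ^ (q : ℝ)) := by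
            refine Real.rpow_le_rpow_of_exponent_le one_le_two
              (Real.rpow_le_rpow_of_exponent_le one_le_two ?_)
            linarith
        _ = ((2 ^ 2 ^ q : ℕ) : ℝ) := hpow q
        _ ≤ AB (n + 3) := by exact_mod_cast h
    by_cases hn : n = 1
    · refine low 1 (by omega) (le_of_not_gt fun hlt => ?_)
      norm_num at hlt
      exact not_forcesAB (q := 1) le_rfl (by norm_num; omega) (Or.inr (by omega)) hAB
    · refine low (n / 2) (by omega) (le_of_not_gt fun hlt => ?_)
      exact not_forcesAB (q := n / 2) (by omega) hlt.le (Or.inl (by omega)) hAB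
  · have h1 : AB (n + 3) ≤ 2 ^ 2 ^ (2 * (n + 3)) := by
      refine (Nat.sInf_le hmem).trans ?_
      have h2 : 2 ^ (2 * n) + 1 ≤ 2 ^ (2 * (n + 3)) := by
        have : 2 ^ (2 * n) < 2 ^ (2 * (n + 3)) := Nat.pow_lt_pow_right (by norm_num) (by omega)
        omega
      calc 2 ^ 2 ^ (2 * n) + 1 ≤ 2 ^ 2 ^ (2 * n) * 2 := by
            have : 1 ≤ 2 ^ 2 ^ (2 * n) := Nat.one_le_two_pow
            omega
        _ = 2 ^ (2 ^ (2 * n) + 1) := (pow_succ _ _).symm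
        _ ≤ 2 ^ 2 ^ (2 * (n + 3)) := Nat.pow_le_pow_right (by norm_num) h2
    have h3 : (2 : ℝ) * ((n + 3 : ℕ) : ℝ) = ((2 * (n + 3) : ℕ) : ℝ) := by push_cast; ring
    rw [h3, hpow]
    exact_mod_cast h1
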